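/- Let $k$ be a commutative ring; algebras are associative unital $k$-algebras, and bimodules are $k$-central (the two induced $k$-actions agree). A Morita context $(R,S,P,Q,\varphi,\psi)$ consists of $k$-algebras $R,S$, an $(S,R)$-bimodule $P$, an $(R,S)$-bimodule $Q$, and bimodule isomorphisms $\varphi\colon P\otimes_R Q\to S$ and $\psi\colon Q\otimes_S P\to R$ with $\varphi(p\otimes q)\,p'=p\,\psi(q\otimes p')$ and $\psi(q\otimes p)\,q'=q\,\varphi(p\otimes q')$ for all $p,p'\in P$, $q,q'\in Q$. A morphism of Morita contexts $(R,S,P,Q,\varphi,\psi)\to(R',S',P',Q',\varphi',\psi')$ consists of $k$-algebra morphisms $R\to R'$, $S\to S'$ and $k$-linear maps $P\to P'$, $Q\to Q'$ that are compatible with the module structures and with $\varphi,\varphi'$ and $\psi,\psi'$. For an $(R,R)$-bimodule $M$ let $H_\bullet(R,M)$ be the Hochschild homology, i.e. the homology of the complex $C_n(R,M)=M\otimes_k R^{\otimes_k n}$ with $$b(m\otimes r_1\otimes\dots\otimes r_n)=mr_1\otimes r_2\otimes\dots\otimes r_n+\sum_{i=1}^{n-1}(-1)^i\, m\otimes\dots\otimes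 r_ir_{i+1}\otimes\dots\otimes r_n+(-1)^n\, r_nm\otimes r_1\otimes\dots\otimes r_{n-1}.$$ Let $HC_\bullet(R)$ be the cyclic homology, i.e. the homology of the total complex of the cyclic bicomplex, which has $C_q(R,R)$ in bidegree $(p,q)$, $p,q\ge 0$, vertical differential $b$ in even and $-b'$ in odd columns (where $b'$ is $b$ without its last summand), and horizontal differential $1-t$ from odd to even columns and $N=1+t+\dots+t^q$ from even columns $p\ge2$ to odd columns, where $t(r_0\otimes\dots\otimes r_q)=(-1)^q\,r_q\otimes r_0\otimes\dots\otimes r_{q-1}$. Then for every Morita context $(R,S,P,Q,\varphi,\psi)$, every $(R,R)$-bimodule $M$ and every $n\ge 0$ there is an isomorphism of $k$-modules $$H_n(R,M)\cong H_n(S,\,P\otimes_R M\otimes_R Q),$$ natural in $M$ and in the Morita context; that is, for every morphism of Morita contexts as above, every $(R',R')$-bimodule $M'$ and every $k$-linear map $M\to M'$ compatible with the bimodule structures along $R\to R'$, these isomorphisms commute with the induced maps. For $M=R$ one has, for every $n\ge0$, isomorphisms of $k$-modules $$HC_n(R)\cong HC_n(S),$$ natural in the Morita context. -/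

import Mathlib

open CategoryTheory TensorProduct MulOpposite

universe u v

namespace MoritaInvariance

noncomputable section

/-! ### Bimodules and their tensor products over a noncommutative algebra -/

/-- An `(A, B)`-bimodule over the commutative ground ring `k`: a left `A`-module and right
`B`-module (i.e. left `Bᵐᵒᵖ`-module) with commuting actions, on which `k` acts centrally, through
either of the two actions. -/
structure Bimodule (k : Type v) [CommRing k] (A B : Type u) [Ring A] [Ring B] [Algebra k A]
    [Algebra k B] where
  carrier : Type u
  [addCommGroup : AddCommGroup carrier]
  [module : Module k carrier]
  [left : Module A carrier]
  [right : Module Bᵐᵒᵖ carrier]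
  [leftTower : IsScalarTower k A carrier]
  [rightTower : IsScalarTower k Bᵐᵒᵖ carrier]
  [comm : SMulCommClass A Bᵐᵒᵖ carrier]

namespace Bimodule

variable {k : Type v} [CommRing k]
  {A B C A' B' C' : Type u} [Ring A] [Ring B] [Ring C] [Ring A'] [Ring B'] [Ring C']
  [Algebra k A] [Algebra k B] [Algebra k C] [Algebra k A'] [Algebra k B'] [Algebra k C']

instance : CoeSort (Bimodule k A B) (Type u) := ⟨Bimodule.carrier⟩

attribute [instance] addCommGroup module left right leftTower rightTower comm

variable (k A) in
/-- The algebra `A` as an `(A, A)`-bimodule. -/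
abbrev self : Bimodule k A A where
  carrier := A

/-- A morphism of bimodules over a pair of algebra morphisms `f : A → A'`, `g : B → B'`. For
identity morphisms `f` and `g` this is a morphism of `(A, B)`-bimodules. -/
structure HomOver (f : A →ₐ[k] A') (g : B →ₐ[k] B') (X : Bimodule k A B)
    (Y : Bimodule k A' B') where
  toLinearMap : X →ₗ[k] Y
  map_smul : ∀ (a : A) (x : X), toLinearMap (a • x) = f a • toLinearMap x
  map_op_smul : ∀ (b : B) (x : X), toLinearMap (op b • x) = op (g b) • toLinearMap x

/-- An algebra morphism `f` as a morphism of bimodules over `(f, f)`. -/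
def HomOver.ofAlgHom (f : A →ₐ[k] A') : HomOver f f (self k A) (self k A') where
  toLinearMap := f.toLinearMap
  map_smul a x := _root_.map_mul f (a : A) (x : A)
  map_op_smul b x := _root_.map_mul f (x : A) (b : A)

/-- An isomorphism of `(A, B)`-bimodules. -/
structure BimodEquiv (X Y : Bimodule k A B) where
  toLinearEquiv : X ≃ₗ[k] Y
  map_smul : ∀ (a : A) (x : X), toLinearEquiv (a • x) = a • toLinearEquiv x
  map_op_smul : ∀ (b : B) (x : X), toLinearEquiv (op b • x) = op b • toLinearEquiv x

section Tensor

variable (X : Bimodule k A B) (Y : Bimodule k B C)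

/-- The submodule of `X ⊗[k] Y` spanned by all `x b ⊗ y - x ⊗ b y`. -/
def balancing : Submodule k (X ⊗[k] Y) :=
  Submodule.span k {z | ∃ (x : X) (b : B) (y : Y), z = (op b • x) ⊗ₜ[k] y - x ⊗ₜ[k] (b • y)}

/-- The tensor product `X ⊗_B Y`. -/
abbrev TensorCarrier : Type u := (X ⊗[k] Y) ⧸ balancing X Y

/-- Left multiplication by `a` on `X ⊗_B Y`. -/
def tensorLeft (a : A) : TensorCarrier X Y →ₗ[k] TensorCarrier X Y :=
  (balancing X Y).mapQ (balancing X Y) (TensorProduct.map (Algebra.lsmul k k X a) LinearMap.id) <| by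
    rw [balancing, Submodule.span_le]
    rintro _ ⟨x, b, y, rfl⟩
    refine Submodule.subset_span ⟨a • x, b, y, ?_⟩
    simp [smul_comm a (op b) x]

/-- Right multiplication by `c` on `X ⊗_B Y`. -/
def tensorRight (c : Cᵐᵒᵖ) : TensorCarrier X Y →ₗ[k] TensorCarrier X Y :=
  (balancing X Y).mapQ (balancing X Y) (TensorProduct.map LinearMap.id (Algebra.lsmul k k Y c)) <| by
    rw [balancing, Submodule.span_le]
    rintro _ ⟨x, b, y, rfl⟩
    refine Submodule.subset_span ⟨x, b, c • y, ?_⟩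
    simp [smul_comm b c y]

variable {X Y} in
theorem tensor_hom_ext {Z : Type*} [AddCommGroup Z] [Module k Z] {f g : TensorCarrier X Y →ₗ[k] Z}
    (h : ∀ (x : X) (y : Y), f (Submodule.Quotient.mk (x ⊗ₜ[k] y)) =
      g (Submodule.Quotient.mk (x ⊗ₜ[k] y))) : f = g :=
  Submodule.linearMap_qext _ (TensorProduct.ext' h)

/-- The left action of `A` on `X ⊗_B Y`. -/
def tensorLeftHom : A →+* Module.End k (TensorCarrier X Y) where
  toFun := tensorLeft X Y
  map_one' := tensor_hom_ext fun x y => by simp [tensorLeft]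
  map_mul' a b := tensor_hom_ext fun x y => by simp [tensorLeft]
  map_zero' := tensor_hom_ext fun x y => by simp [tensorLeft]
  map_add' a b := tensor_hom_ext fun x y => by simp [tensorLeft, TensorProduct.add_tmul]

/-- The right action of `C` on `X ⊗_B Y`. -/
def tensorRightHom : Cᵐᵒᵖ →+* Module.End k (TensorCarrier X Y) where
  toFun := tensorRight X Y
  map_one' := tensor_hom_ext fun x y => by simp [tensorRight]
  map_mul' a b := tensor_hom_ext fun x y => by simp [tensorRight]
  map_zero' := tensor_hom_ext fun x y => by simp [tensorRight]
  map_add' a b := tensor_hom_ext fun x y => by simp [tensorRight, TensorProduct.tmul_add]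

/-- The `(A, C)`-bimodule `X ⊗_B Y`, with `a (x ⊗ y) c = a x ⊗ y c`. -/
def tensor : Bimodule k A C where
  carrier := TensorCarrier X Y
  left := Module.compHom (TensorCarrier X Y) (tensorLeftHom X Y)
  right := Module.compHom (TensorCarrier X Y) (tensorRightHom X Y)
  leftTower :=
    letI := Module.compHom (TensorCarrier X Y) (tensorLeftHom X Y)
    ⟨fun r a z => LinearMap.congr_fun (f := tensorLeft X Y (r • a)) (g := r • tensorLeft X Y a)
      (tensor_hom_ext fun x y => by
        simp [tensorLeft, ← TensorProduct.smul_tmul']) z⟩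
  rightTower :=
    letI := Module.compHom (TensorCarrier X Y) (tensorRightHom X Y)
    ⟨fun r c z => LinearMap.congr_fun (f := tensorRight X Y (r • c)) (g := r • tensorRight X Y c)
      (tensor_hom_ext fun x y => by simp [tensorRight]) z⟩
  comm :=
    letI := Module.compHom (TensorCarrier X Y) (tensorLeftHom X Y)
    letI := Module.compHom (TensorCarrier X Y) (tensorRightHom X Y)
    ⟨fun a c z => LinearMap.congr_fun (f := tensorLeft X Y a ∘ₗ tensorRight X Y c)
      (g := tensorRight X Y c ∘ₗ tensorLeft X Y a)
      (tensor_hom_ext fun x y => by simp [tensorLeft, tensorRight]) z⟩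

variable {X Y}

/-- The pure tensor `x ⊗_B y`. -/
def tmul (x : X) (y : Y) : X.tensor Y :=
  (Submodule.Quotient.mk (x ⊗ₜ[k] y) : TensorCarrier X Y)

theorem smul_tmul_left (a : A) (x : X) (y : Y) : a • tmul x y = tmul (a • x) y := rfl

theorem op_smul_tmul (c : C) (x : X) (y : Y) : op c • tmul x y = tmul x (op c • y) := rfl

theorem tmul_balanced (x : X) (b : B) (y : Y) : tmul (op b • x) y = tmul x (b • y) :=
  (Submodule.Quotient.eq _).2 (Submodule.subset_span ⟨x, b, y, rfl⟩)

/-- The morphism `μ ⊗ ν : X ⊗_B Y → X' ⊗_{B'} Y'`, `x ⊗ y ↦ μ x ⊗ ν y`. -/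
def HomOver.tensor {f : A →ₐ[k] A'} {g : B →ₐ[k] B'} {h : C →ₐ[k] C'}
    {X' : Bimodule k A' B'} {Y' : Bimodule k B' C'} (μ : HomOver f g X X') (ν : HomOver g h Y Y') :
    HomOver f h (X.tensor Y) (X'.tensor Y') :=
  let F : TensorCarrier X Y →ₗ[k] TensorCarrier X' Y' :=
    (balancing X Y).mapQ (balancing X' Y')
      (TensorProduct.map μ.toLinearMap ν.toLinearMap) <| by
        rw [balancing, Submodule.span_le]
        rintro _ ⟨x, b, y, rfl⟩
        refine Submodule.subset_span ⟨μ.toLinearMap x, g b, ν.toLinearMap y, ?_⟩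
        simp [μ.map_op_smul, ν.map_smul]
  { toLinearMap := F
    map_smul := fun a z => LinearMap.congr_fun (f := F ∘ₗ tensorLeft X Y a)
      (g := tensorLeft X' Y' (f a) ∘ₗ F)
      (tensor_hom_ext fun x y => by simp [F, tensorLeft, μ.map_smul]) z
    map_op_smul := fun c z => LinearMap.congr_fun (f := F ∘ₗ tensorRight X Y (op c))
      (g := tensorRight X' Y' (op (h c)) ∘ₗ F)
      (tensor_hom_ext fun x y => by simp [F, tensorRight, ν.map_op_smul]) z }

end Tensor

end Bimodule

/-! ### Morita contexts -/

/-- A Morita context `(R, S, P, Q, φ, ψ)`: two `k`-algebras, bimodules `P` over `(S, R)` and `Q`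
over `(R, S)`, and bimodule isomorphisms `φ : P ⊗_R Q ≃ S` and `ψ : Q ⊗_S P ≃ R` such that
`φ (p ⊗ q) p' = p ψ (q ⊗ p')` and `ψ (q ⊗ p) q' = q φ (p ⊗ q')`. -/
structure MoritaContext (k : Type v) [CommRing k] where
  R : Type u
  S : Type u
  [ringR : Ring R]
  [ringS : Ring S]
  [algebraR : Algebra k R]
  [algebraS : Algebra k S]
  P : Bimodule k S R
  Q : Bimodule k R S
  φ : Bimodule.BimodEquiv (P.tensor Q) (Bimodule.self k S)
  ψ : Bimodule.BimodEquiv (Q.tensor P) (Bimodule.self k R)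
  φ_smul : ∀ (p : P) (q : Q) (p' : P),
    (φ.toLinearEquiv (Bimodule.tmul p q) : S) • p' =
      op (ψ.toLinearEquiv (Bimodule.tmul q p') : R) • p
  ψ_smul : ∀ (q : Q) (p : P) (q' : Q),
    (ψ.toLinearEquiv (Bimodule.tmul q p) : R) • q' =
      op (φ.toLinearEquiv (Bimodule.tmul p q') : S) • q

namespace MoritaContext

variable {k : Type v} [CommRing k]

attribute [instance] ringR ringS algebraR algebraS

/-- A morphism of Morita contexts: algebra morphisms `R → R'`, `S → S'` and compatible morphisms
of bimodules `P → P'`, `Q → Q'` that commute with the pairings. -/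
structure Hom (𝓒 𝓓 : MoritaContext.{u} k) where
  onR : 𝓒.R →ₐ[k] 𝓓.R
  onS : 𝓒.S →ₐ[k] 𝓓.S
  onP : Bimodule.HomOver onS onR 𝓒.P 𝓓.P
  onQ : Bimodule.HomOver onR onS 𝓒.Q 𝓓.Q
  map_φ : ∀ z, 𝓓.φ.toLinearEquiv ((onP.tensor onQ).toLinearMap z) = onS (𝓒.φ.toLinearEquiv z)
  map_ψ : ∀ z, 𝓓.ψ.toLinearEquiv ((onQ.tensor onP).toLinearMap z) = onR (𝓒.ψ.toLinearEquiv z)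

/-- The `(S, S)`-bimodule `P ⊗_R M ⊗_R Q`. -/
def baseChange (𝓒 : MoritaContext.{u} k) (M : Bimodule k 𝓒.R 𝓒.R) : Bimodule k 𝓒.S 𝓒.S :=
  (𝓒.P.tensor M).tensor 𝓒.Q

/-- The morphism `P ⊗_R M ⊗_R Q → P' ⊗_{R'} M' ⊗_{R'} Q'` induced by a morphism of Morita contexts
and a morphism of bimodules `M → M'` over it. -/
def Hom.baseChange {𝓒 𝓓 : MoritaContext.{u} k} (F : Hom 𝓒 𝓓) {M : Bimodule k 𝓒.R 𝓒.R}
    {N : Bimodule k 𝓓.R 𝓓.R} (μ : Bimodule.HomOver F.onR F.onR M N) :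
    Bimodule.HomOver F.onS F.onS (𝓒.baseChange M) (𝓓.baseChange N) :=
  (F.onP.tensor μ).tensor F.onQ

end MoritaContext

/-! ### Hochschild chains -/

section Chains

variable (k : Type v) [CommRing k] (R M : Type u) [Ring R] [Algebra k R] [AddCommGroup M]
  [Module k M]

/-- The module of Hochschild chains `C_n(R, M) = M ⊗ R ⊗ ⋯ ⊗ R` with `n` factors `R`, all tensor
products being over `k`. -/
def Chains (n : ℕ) : Type (max u v) := M ⊗[k] (⨂[k] (_ : Fin n), R)

instance (n : ℕ) : AddCommGroup (Chains k R M n) :=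
  inferInstanceAs (AddCommGroup (M ⊗[k] (⨂[k] (_ : Fin n), R)))

instance (n : ℕ) : Module k (Chains k R M n) :=
  inferInstanceAs (Module k (M ⊗[k] (⨂[k] (_ : Fin n), R)))

variable {R M}

/-- The pure tensor `m ⊗ r₁ ⊗ ⋯ ⊗ rₙ`. -/
def pureTensor {n : ℕ} (x : M × (Fin n → R)) : Chains k R M n :=
  (x.1 ⊗ₜ[k] PiTensorProduct.tprod k x.2 : M ⊗[k] (⨂[k] (_ : Fin n), R))

section

variable {n : ℕ}

theorem pureTensor_add (m m' : M) (r : Fin n → R) :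
    pureTensor k (m + m', r) = pureTensor k (m, r) + pureTensor k (m', r) :=
  TensorProduct.add_tmul _ _ _

theorem pureTensor_smul (c : k) (m : M) (r : Fin n → R) : pureTensor k (c • m, r) = c • pureTensor k (m, r) :=
  rfl

theorem pureTensor_update_add (m : M) (r : Fin n → R) (i : Fin n) (a a' : R) :
    pureTensor k (m, Function.update r i (a + a')) =
      pureTensor k (m, Function.update r i a) + pureTensor k (m, Function.update r i a') := by
  simp only [pureTensor, MultilinearMap.map_update_add]
  exact TensorProduct.tmul_add _ _ _

theorem pureTensor_update_smul (m : M) (r : Fin n → R) (i : Fin n) (c : k) (a : R) :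
    pureTensor k (m, Function.update r i (c • a)) = c • pureTensor k (m, Function.update r i a) := by
  simp only [pureTensor, MultilinearMap.map_update_smul]
  exact TensorProduct.tmul_smul _ _ _

variable {k} {Z : Type*} [AddCommGroup Z] [Module k Z]

theorem chains_hom_ext {f g : Chains k R M n →ₗ[k] Z} (h : ∀ x, f (pureTensor k x) = g (pureTensor k x)) :
    f = g := by
  refine TensorProduct.ext (P₂ := Z) (M := M) (N := ⨂[k] (_ : Fin n), R) ?_
  refine LinearMap.ext fun m => PiTensorProduct.ext (MultilinearMap.ext fun r => ?_)
  exact h (m, r)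

/-- The linear map on chains with the given values on pure tensors. -/
def chainsLift (F : M →ₗ[k] MultilinearMap k (fun _ : Fin n => R) Z) : Chains k R M n →ₗ[k] Z :=
  TensorProduct.lift ((PiTensorProduct.lift (R := k) (s := fun _ : Fin n => R)
    (E := Z)).toLinearMap ∘ₗ F)

theorem chainsLift_pureTensor (F : M →ₗ[k] MultilinearMap k (fun _ : Fin n => R) Z)
    (x : M × (Fin n → R)) : chainsLift F (pureTensor k x) = F x.1 x.2 := by
  refine (TensorProduct.lift.tmul _ _).trans ?_
  simp

end

/-- The map on chains induced by an algebra morphism and a linear map of coefficients,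
`m ⊗ r₁ ⊗ ⋯ ⊗ rₙ ↦ μ m ⊗ f r₁ ⊗ ⋯ ⊗ f rₙ`. -/
def chainsMap {R' M' : Type u} [Ring R'] [Algebra k R'] [AddCommGroup M'] [Module k M']
    (f : R →ₐ[k] R') (μ : M →ₗ[k] M') (n : ℕ) : Chains k R M n →ₗ[k] Chains k R' M' n :=
  TensorProduct.map (M := M) (M₂ := M') μ (PiTensorProduct.map fun _ => f.toLinearMap)

theorem chainsMap_pureTensor {R' M' : Type u} [Ring R'] [Algebra k R'] [AddCommGroup M'] [Module k M']
    (f : R →ₐ[k] R') (μ : M →ₗ[k] M') (n : ℕ) (x : M × (Fin n → R)) :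
    chainsMap k f μ n (pureTensor k x) = pureTensor k (μ x.1, fun i => f (x.2 i)) := by
  refine (TensorProduct.map_tmul μ (PiTensorProduct.map fun _ => f.toLinearMap) x.1
    (PiTensorProduct.tprod k x.2)).trans ?_
  simp [pureTensor, PiTensorProduct.map_tprod]

variable [Module R M] [Module Rᵐᵒᵖ M]

/-- The `i`-th face of the tuple `(m, r₁, …, rₙ₊₁)`: it is `(m r₁, r₂, …, rₙ₊₁)` for `i = 0`,
`(m, r₁, …, rᵢ rᵢ₊₁, …, rₙ₊₁)` for `0 < i < n + 1` and `(rₙ₊₁ m, r₁, …, rₙ)` for `i = n + 1`. -/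
def faceTuple {n : ℕ} (i : Fin (n + 2)) (x : M × (Fin (n + 1) → R)) : M × (Fin n → R) :=
  (if (i : ℕ) = 0 then op (x.2 0) • x.1
    else if (i : ℕ) = n + 1 then x.2 (Fin.last n) • x.1
    else x.1,
    fun j =>
      if (j : ℕ) + 1 < i then x.2 j.castSucc
      else if (j : ℕ) + 1 = i then x.2 j.castSucc * x.2 j.succ
      else x.2 j.succ)

theorem faceTuple_faceTuple [SMulCommClass R Rᵐᵒᵖ M] {n : ℕ} (i j : Fin (n + 2)) (h : i ≤ j)
    (x : M × (Fin (n + 2) → R)) :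
    faceTuple i (faceTuple j.succ x) = faceTuple j (faceTuple i.castSucc x) := by
  obtain ⟨i, hi⟩ := i
  obtain ⟨j, hj⟩ := j
  obtain ⟨m, r⟩ := x
  simp only [Fin.mk_le_mk] at h
  refine Prod.ext ?_ (funext fun a => ?_)
  · rcases Nat.eq_zero_or_pos i with rfl | h0
    · rcases Nat.eq_zero_or_pos j with rfl | h1
      · simp [faceTuple, mul_smul]
      · by_cases hl : j = n + 1
        · subst hl
          simp [faceTuple, smul_comm]
        · have : ¬ j = 0 := by omega
          simp [faceTuple, hl, this, h1]
    · have h1 : ¬ j = 0 := by omega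
      have h2 : ¬ i = 0 := by omega
      by_cases hl : j = n + 1
      · subst hl
        by_cases hk : i = n + 1
        · subst hk
          simp [faceTuple, mul_smul]
        · have : ¬ i = n + 2 := by omega
          have : ¬ n + 1 < i := by omega
          simp [faceTuple, *]
          grind
      · have : ¬ i = n + 2 := by omega
        have : ¬ i = n + 1 := by omega
        simp [faceTuple, *]
  · obtain ⟨a, ha⟩ := a
    simp only [faceTuple, Fin.castSucc_mk, Fin.succ_mk]
    split_ifs <;> first | rfl | omega | simp [mul_assoc]

variable [IsScalarTower k R M] [IsScalarTower k Rᵐᵒᵖ M]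

theorem faceTuple_update {n : ℕ} (i : Fin (n + 2)) (m : M) (r : Fin (n + 1) → R)
    (a : Fin (n + 1)) :
    (∃ L : R →ₗ[k] M, ∀ c, faceTuple i (m, Function.update r a c) =
      (L c, (faceTuple i (m, r)).2)) ∨
    (∃ (s : Fin n) (L : R →ₗ[k] R), ∀ c, faceTuple i (m, Function.update r a c) =
      ((faceTuple i (m, r)).1, Function.update (faceTuple i (m, r)).2 s (L c))) := by
  obtain ⟨i, hi⟩ := i
  obtain ⟨a, ha⟩ := a
  by_cases h : a < i
  · by_cases hn : a < n
    · have h' : a + 1 ≤ i := h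
      refine Or.inr ⟨⟨a, hn⟩, if a + 1 = i then LinearMap.mulRight k (r ⟨a + 1, by omega⟩)
        else LinearMap.id, fun c => Prod.ext ?_ (funext fun j => ?_)⟩
      · simp only [faceTuple, Function.update_apply, Fin.ext_iff, Fin.val_last, Fin.val_zero]
        split_ifs <;> first | rfl | omega
      · obtain ⟨j, hj⟩ := j
        simp only [faceTuple, Function.update_apply, Fin.ext_iff, Fin.castSucc_mk, Fin.succ_mk]
        split_ifs <;> first | rfl | omega | (subst_vars; rfl)
    · refine Or.inl ⟨(LinearMap.toSpanSingleton R M m).restrictScalars k, fun c => Prod.ext ?_ (funext fun j => ?_)⟩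
      · simp only [faceTuple, Function.update_apply, Fin.ext_iff, Fin.val_last, Fin.val_zero]
        split_ifs <;> first | rfl | omega
      · obtain ⟨j, hj⟩ := j
        simp only [faceTuple, Function.update_apply, Fin.ext_iff, Fin.castSucc_mk, Fin.succ_mk]
        split_ifs <;> first | rfl | omega
  · by_cases h0 : a = 0
    · refine Or.inl ⟨(LinearMap.toSpanSingleton Rᵐᵒᵖ M m).restrictScalars k ∘ₗ
        (opLinearEquiv k).toLinearMap, fun c => Prod.ext ?_ (funext fun j => ?_)⟩
      · simp only [faceTuple, Function.update_apply, Fin.ext_iff, Fin.val_last, Fin.val_zero]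
        split_ifs <;> first | rfl | omega
      · obtain ⟨j, hj⟩ := j
        simp only [faceTuple, Function.update_apply, Fin.ext_iff, Fin.castSucc_mk, Fin.succ_mk]
        split_ifs <;> first | rfl | omega
    · obtain ⟨a, rfl⟩ := Nat.exists_eq_succ_of_ne_zero h0
      refine Or.inr ⟨⟨a, by omega⟩, if a + 1 = i then LinearMap.mulLeft k (r ⟨a, by omega⟩)
        else LinearMap.id, fun c => Prod.ext ?_ (funext fun j => ?_)⟩
      · simp only [faceTuple, Function.update_apply, Fin.ext_iff, Fin.val_last, Fin.val_zero]
        split_ifs <;> first | rfl | contradiction | omega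
      · obtain ⟨j, hj⟩ := j
        simp only [faceTuple, Function.update_apply, Fin.ext_iff, Fin.castSucc_mk, Fin.succ_mk]
        split_ifs <;> first | rfl | omega | (subst_vars; rfl)

/-- The face operator `d_i : C_{n+1}(R, M) → C_n(R, M)`. -/
def face {n : ℕ} (i : Fin (n + 2)) : Chains k R M (n + 1) →ₗ[k] Chains k R M n :=
  chainsLift
    { toFun := fun m =>
        MultilinearMap.mk' (fun r => pureTensor k (faceTuple i (m, r)))
          (fun r a c c' => by
            rcases faceTuple_update k i m r a with ⟨L, hL⟩ | ⟨s, L, hL⟩ <;>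
              simp [hL, pureTensor_add, pureTensor_update_add])
          (fun r a t c => by
            rcases faceTuple_update k i m r a with ⟨L, hL⟩ | ⟨s, L, hL⟩ <;>
              simp [hL, pureTensor_smul, pureTensor_update_smul])
      map_add' := fun m m' => by
        ext r
        simp only [MultilinearMap.mk'_apply, add_apply, faceTuple, ← pureTensor_add]
        split_ifs <;> simp
      map_smul' := fun t m => by
        ext r
        simp only [MultilinearMap.mk'_apply, smul_apply, faceTuple, RingHom.id_apply, ← pureTensor_smul]
        split_ifs
        · rw [smul_comm]
        · rw [smul_comm]
        · rfl }

theorem face_pureTensor {n : ℕ} (i : Fin (n + 2)) (x : M × (Fin (n + 1) → R)) :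
    face k i (pureTensor k x) = pureTensor k (faceTuple i x) :=
  chainsLift_pureTensor _ _

theorem face_comp_face [SMulCommClass R Rᵐᵒᵖ M] {n : ℕ} (i j : Fin (n + 2)) (h : i ≤ j) :
    face (R := R) (M := M) k i ∘ₗ face k j.succ = face k j ∘ₗ face k i.castSucc :=
  chains_hom_ext fun x => by simp [face_pureTensor, faceTuple_faceTuple i j h]

variable (R M) in
/-- The Hochschild boundary `b = ∑_{i = 0}^{n + 1} (-1)^i d_i`. -/
def hochschildBoundary (n : ℕ) : Chains k R M (n + 1) →ₗ[k] Chains k R M n :=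
  ∑ i : Fin (n + 2), (-1 : ℤ) ^ (i : ℕ) • face k i

variable (R M) in
/-- The operator `b' = ∑_{i = 0}^{n} (-1)^i d_i`, in which the last face is omitted. -/
def barBoundary (n : ℕ) : Chains k R M (n + 1) →ₗ[k] Chains k R M n :=
  ∑ i : Fin (n + 1), (-1 : ℤ) ^ (i : ℕ) • face k i.castSucc

section Sums

variable {k} {ι X Y Z : Type*} [AddCommGroup X] [AddCommGroup Y] [AddCommGroup Z] [Module k X]
  [Module k Y] [Module k Z]

theorem sum_comp (s : Finset ι) (f : ι → Y →ₗ[k] Z) (g : X →ₗ[k] Y) :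
    (∑ i ∈ s, f i) ∘ₗ g = ∑ i ∈ s, f i ∘ₗ g := by
  ext x
  simp

theorem comp_sum (s : Finset ι) (f : ι → X →ₗ[k] Y) (g : Y →ₗ[k] Z) :
    g ∘ₗ (∑ i ∈ s, f i) = ∑ i ∈ s, g ∘ₗ f i := by
  ext x
  simp

end Sums

theorem alternating_double_sum {Z : Type*} [AddCommGroup Z] {n : ℕ}
    (F : Fin (n + 1) → Fin (n + 2) → Z)
    (hF : ∀ i j : Fin (n + 1), i ≤ j → F i j.succ = F j i.castSucc) :
    ∑ i : Fin (n + 1), ∑ j : Fin (n + 2), ((-1 : ℤ) ^ (i : ℕ) * (-1) ^ (j : ℕ)) • F i j = 0 := by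
  simp only [← Finset.sum_product']
  refine Finset.sum_involution
    (fun x _ => if h : x.2 ≤ x.1.castSucc then
        (⟨x.2, lt_of_le_of_lt h x.1.2⟩, x.1.succ)
      else (x.2.pred (by rintro h'; simp [h'] at h), x.1.castSucc)) ?_ ?_ ?_ ?_
  · rintro ⟨i, j⟩ -
    by_cases h : j ≤ i.castSucc
    · have := hF ⟨j, lt_of_le_of_lt h i.2⟩ i h
      have e : (⟨j, lt_of_le_of_lt h i.2⟩ : Fin (n + 1)).castSucc = j := rfl
      simp only [h, dite_true, this, e, ← add_smul, Fin.val_succ]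
      rw [pow_succ]
      convert zero_smul ℤ (F i j) using 2
      ring
    · obtain rfl | ⟨j, rfl⟩ := Fin.eq_zero_or_eq_succ j
      · exact absurd (Fin.zero_le _) h
      have hij : i ≤ j := Fin.le_def.2 (Nat.lt_succ_iff.1 (Fin.lt_def.1 (not_le.1 h)))
      have := hF i j hij
      simp only [h, dite_false, this, Fin.pred_succ, ← add_smul, Fin.val_succ, Fin.val_castSucc]
      rw [pow_succ]
      convert zero_smul ℤ (F j i.castSucc) using 2
      ring
  · rintro ⟨i, j⟩ - - h
    by_cases h' : j ≤ i.castSucc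
    · have := congrArg (fun x => (x.2 : ℕ)) h
      simp only [h', dite_true, Fin.val_succ] at this
      have : (j : ℕ) ≤ i := h'
      omega
    · have := congrArg (fun x => (x.2 : ℕ)) h
      simp only [h', dite_false, Fin.val_castSucc] at this
      exact h' (Fin.le_def.2 this.ge)
  · simp
  · rintro ⟨i, j⟩ -
    by_cases h : j ≤ i.castSucc
    · have : ¬ i.succ ≤ j := by simp [Fin.le_def] at h ⊢; omega
      simp [h, Fin.ext_iff, Fin.le_def]
      simp [Fin.le_def] at h this
      grind
    · obtain rfl | ⟨j, rfl⟩ := Fin.eq_zero_or_eq_succ j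
      · exact absurd (Fin.zero_le _) h
      have hij : i ≤ j := Fin.le_def.2 (Nat.lt_succ_iff.1 (Fin.lt_def.1 (not_le.1 h)))
      simp [h, hij]

theorem hochschildBoundary_comp [SMulCommClass R Rᵐᵒᵖ M] (n : ℕ) :
    hochschildBoundary k R M n ∘ₗ hochschildBoundary k R M (n + 1) = 0 := by
  simp only [hochschildBoundary, sum_comp, comp_sum, LinearMap.smul_comp,
    LinearMap.comp_smul]
  rw [← alternating_double_sum (fun (i : Fin (n + 2)) (j : Fin (n + 3)) =>
    face (R := R) (M := M) k i ∘ₗ face k j) fun i j h => face_comp_face k i j h]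
  rw [Finset.sum_comm]
  simp [mul_comm, Finset.smul_sum, smul_smul]

theorem barBoundary_comp [SMulCommClass R Rᵐᵒᵖ M] (n : ℕ) :
    barBoundary k R M n ∘ₗ barBoundary k R M (n + 1) = 0 := by
  simp only [barBoundary, sum_comp, comp_sum, LinearMap.smul_comp,
    LinearMap.comp_smul]
  rw [← alternating_double_sum (fun (i : Fin (n + 1)) (j : Fin (n + 2)) =>
    face (R := R) (M := M) k i.castSucc ∘ₗ face k j.castSucc) fun i j h => by
      simpa using face_comp_face (R := R) (M := M) k i.castSucc j.castSucc (by simpa using h)]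
  rw [Finset.sum_comm]
  simp [mul_comm, Finset.smul_sum, smul_smul]

section Map

variable {R' M' : Type u} [Ring R'] [Algebra k R'] [AddCommGroup M'] [Module k M']
  [Module R' M'] [Module R'ᵐᵒᵖ M'] [IsScalarTower k R' M'] [IsScalarTower k R'ᵐᵒᵖ M']
  (f : R →ₐ[k] R') (μ : M →ₗ[k] M')

theorem face_comp_chainsMap (hl : ∀ (r : R) (m : M), μ (r • m) = f r • μ m)
    (hr : ∀ (r : R) (m : M), μ (op r • m) = op (f r) • μ m)
    {n : ℕ} (i : Fin (n + 2)) :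
    face k i ∘ₗ chainsMap k f μ (n + 1) = chainsMap k f μ n ∘ₗ face k i :=
  chains_hom_ext fun x => by
    simp only [LinearMap.comp_apply, face_pureTensor, chainsMap_pureTensor]
    congr 1
    refine Prod.ext ?_ (funext fun j => ?_) <;> simp only [faceTuple] <;> split_ifs <;> simp [hl, hr]

theorem hochschildBoundary_comp_chainsMap (hl : ∀ (r : R) (m : M), μ (r • m) = f r • μ m)
    (hr : ∀ (r : R) (m : M), μ (op r • m) = op (f r) • μ m)
    (n : ℕ) :
    hochschildBoundary k R' M' n ∘ₗ chainsMap k f μ (n + 1) =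
      chainsMap k f μ n ∘ₗ hochschildBoundary k R M n := by
  simp only [hochschildBoundary, sum_comp, comp_sum, LinearMap.smul_comp,
    LinearMap.comp_smul, face_comp_chainsMap k f μ hl hr]

theorem barBoundary_comp_chainsMap (hl : ∀ (r : R) (m : M), μ (r • m) = f r • μ m)
    (hr : ∀ (r : R) (m : M), μ (op r • m) = op (f r) • μ m)
    (n : ℕ) :
    barBoundary k R' M' n ∘ₗ chainsMap k f μ (n + 1) =
      chainsMap k f μ n ∘ₗ barBoundary k R M n := by
  simp only [barBoundary, sum_comp, comp_sum, LinearMap.smul_comp,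
    LinearMap.comp_smul, face_comp_chainsMap k f μ hl hr]

end Map

end Chains

/-! ### The cyclic operator and the cyclic bicomplex -/

section Cyclic

variable (k : Type v) [CommRing k] (R : Type u) [Ring R] [Algebra k R]

/-- The cyclic rotation `(r₀, r₁, …, rₙ) ↦ (rₙ, r₀, …, rₙ₋₁)`. -/
def rotTuple {R : Type u} : {n : ℕ} → R × (Fin n → R) → R × (Fin n → R)
  | 0, x => x
  | n + 1, x => (x.2 (Fin.last n), Fin.cons x.1 fun j => x.2 j.castSucc)

section

variable {R : Type u} {n : ℕ} (a : R) (r : Fin (n + 1) → R) (c : R)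

theorem rotTuple_update_last :
    rotTuple (a, Function.update r (Fin.last n) c) = (c, (rotTuple (a, r)).2) := by
  simp [rotTuple, Fin.castSucc_ne_last]

theorem rotTuple_update_castSucc (i : Fin n) :
    rotTuple (a, Function.update r i.castSucc c) =
      ((rotTuple (a, r)).1, Function.update (rotTuple (a, r)).2 i.succ c) := by
  refine Prod.ext ?_ (funext fun j => ?_)
  · simp [rotTuple, Function.update_apply, (Fin.castSucc_ne_last i).symm]
  · obtain rfl | ⟨j, rfl⟩ := Fin.eq_zero_or_eq_succ j
    · simp [rotTuple, Function.update_apply, (Fin.succ_ne_zero i).symm]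
    · simp [rotTuple, Function.update_apply]

end

/-- The operator `r₀ ⊗ r₁ ⊗ ⋯ ⊗ rₙ ↦ rₙ ⊗ r₀ ⊗ ⋯ ⊗ rₙ₋₁`. -/
def rot : (n : ℕ) → Chains k R R n →ₗ[k] Chains k R R n
  | 0 => LinearMap.id
  | n + 1 => chainsLift
    { toFun := fun a =>
        MultilinearMap.mk' (fun r => pureTensor k (rotTuple (a, r)))
          (fun r i c c' => by
            refine Fin.lastCases ?_ (fun i => ?_) i <;>
              simp [rotTuple_update_last, rotTuple_update_castSucc, pureTensor_add, pureTensor_update_add])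
          (fun r i t c => by
            refine Fin.lastCases ?_ (fun i => ?_) i <;>
              simp [rotTuple_update_last, rotTuple_update_castSucc, pureTensor_smul, pureTensor_update_smul])
      map_add' := fun a a' => by
        ext r
        simpa [rotTuple] using pureTensor_update_add k (r (Fin.last n))
          (Fin.cons 0 fun j => r j.castSucc : Fin (n + 1) → R) 0 a a'
      map_smul' := fun t a => by
        ext r
        simpa [rotTuple] using pureTensor_update_smul k (r (Fin.last n))
          (Fin.cons 0 fun j => r j.castSucc : Fin (n + 1) → R) 0 t a }

theorem rot_pureTensor {n : ℕ} (x : R × (Fin n → R)) : rot k R n (pureTensor k x) = pureTensor k (rotTuple x) := by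
  cases n
  · rfl
  · exact chainsLift_pureTensor _ _

/-- The cyclic operator `t_n`, with its sign: `r₀ ⊗ r₁ ⊗ ⋯ ⊗ rₙ ↦ (-1)^n rₙ ⊗ r₀ ⊗ ⋯ ⊗ rₙ₋₁`. -/
def cyclicOp (n : ℕ) : Module.End k (Chains k R R n) := (-1 : ℤ) ^ n • rot k R n

/-- The norm operator `N = 1 + t + ⋯ + t ^ n`. -/
def normOp (n : ℕ) : Module.End k (Chains k R R n) := ∑ j ∈ Finset.range (n + 1), cyclicOp k R n ^ j

theorem cons_rotTuple {R : Type u} {n : ℕ} (x : R × (Fin n → R)) (i : Fin (n + 1)) :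
    (Fin.cons (rotTuple x).1 (rotTuple x).2 : Fin (n + 1) → R) i =
      (Fin.cons x.1 x.2 : Fin (n + 1) → R) (i - 1) := by
  cases n with
  | zero =>
    have : i - 1 = i := Fin.ext (by omega)
    rw [this]
    rfl
  | succ n =>
    refine Fin.cases ?_ (fun j => ?_) i
    · have : (0 : Fin (n + 2)) - 1 = (Fin.last n).succ := by
        rw [sub_eq_iff_eq_add, Fin.succ_last, Fin.last_add_one]
      rw [this, Fin.cons_succ]
      rfl
    · have : j.succ - 1 = j.castSucc := by
        rw [sub_eq_iff_eq_add, Fin.coeSucc_eq_succ]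
      rw [this, Fin.cons_succ]
      refine Fin.cases rfl (fun l => ?_) j
      rw [← Fin.succ_castSucc]
      rfl

theorem cons_iterate_rotTuple {R : Type u} {n : ℕ} (x : R × (Fin n → R)) (j : ℕ)
    (i : Fin (n + 1)) :
    (Fin.cons (rotTuple^[j] x).1 (rotTuple^[j] x).2 : Fin (n + 1) → R) i =
      (Fin.cons x.1 x.2 : Fin (n + 1) → R) (i - j • (1 : Fin (n + 1))) := by
  induction j generalizing i with
  | zero => simp
  | succ j ih =>
    rw [Function.iterate_succ_apply', cons_rotTuple, ih]
    rw [succ_nsmul', sub_sub]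

theorem cyclicOp_pow (n : ℕ) : cyclicOp k R n ^ (n + 1) = 1 := by
  have h (j : ℕ) (x : R × (Fin n → R)) :
      (rot k R n ^ j) (pureTensor k x) = pureTensor k (rotTuple^[j] x) := by
    induction j with
    | zero => rfl
    | succ j ih =>
      rw [pow_succ', Module.End.mul_apply, ih, rot_pureTensor, Function.iterate_succ_apply']
  have h' : rot k R n ^ (n + 1) = 1 := chains_hom_ext fun x => by
    have hx : (Fin.cons (rotTuple^[n + 1] x).1 (rotTuple^[n + 1] x).2 : Fin (n + 1) → R) =
        Fin.cons x.1 x.2 := funext fun i => by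
      have : (n + 1) • (1 : Fin (n + 1)) = 0 := by
        simpa using card_nsmul_eq_zero (x := (1 : Fin (n + 1)))
      rw [cons_iterate_rotTuple, this, sub_zero]
    rw [h, Prod.ext (Fin.cons_inj.1 hx).1 (Fin.cons_inj.1 hx).2]
    rfl
  rw [cyclicOp, smul_pow, h', ← pow_mul, (Nat.even_mul_succ_self n).neg_one_pow, one_smul]

variable {R} in
theorem faceTuple_succ_rotTuple {n : ℕ} (i : Fin (n + 1)) (x : R × (Fin (n + 1) → R)) :
    faceTuple i.succ (rotTuple x) = rotTuple (faceTuple i.castSucc x) := by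
  obtain ⟨i, hi⟩ := i
  obtain ⟨m, r⟩ := x
  cases n with
  | zero =>
    obtain rfl : i = 0 := by omega
    refine Prod.ext ?_ (funext fun a => a.elim0)
    simp [faceTuple, rotTuple]
  | succ n =>
    refine Prod.ext ?_ (funext fun a => ?_)
    · simp only [faceTuple, rotTuple, Fin.val_succ, Fin.val_castSucc, Fin.val_last, Fin.succ_last]
      split_ifs <;> first | rfl | contradiction | omega
    · refine Fin.cases ?_ (fun a => ?_) a
      · simp [faceTuple, rotTuple]
        split_ifs <;> first | rfl | omega
      · obtain ⟨a, ha⟩ := a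
        simp only [faceTuple, rotTuple, Fin.val_succ, Fin.val_castSucc, Fin.cons_succ]
        split_ifs <;> first | rfl | omega

variable {R} in
theorem faceTuple_zero_rotTuple {n : ℕ} (x : R × (Fin (n + 1) → R)) :
    faceTuple 0 (rotTuple x) = faceTuple (Fin.last (n + 1)) x := by
  refine Prod.ext ?_ (funext fun a => ?_)
  · simp [faceTuple, rotTuple]
  · simp [faceTuple, rotTuple]

/-- The face operators with their signs. -/
def signedFace (n : ℕ) (i : Fin (n + 2)) : Chains k R R (n + 1) →ₗ[k] Chains k R R n :=
  (-1 : ℤ) ^ (i : ℕ) • face k i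

theorem signedFace_succ (n : ℕ) (i : Fin (n + 1)) :
    signedFace k R n i.succ ∘ₗ cyclicOp k R (n + 1) =
      cyclicOp k R n ∘ₗ signedFace k R n i.castSucc := by
  have : face k i.succ ∘ₗ rot k R (n + 1) = rot k R n ∘ₗ face k i.castSucc :=
    chains_hom_ext fun x => by simp [face_pureTensor, rot_pureTensor, faceTuple_succ_rotTuple]
  simp only [signedFace, cyclicOp, LinearMap.smul_comp, LinearMap.comp_smul, smul_smul, this]
  congr 1
  simp only [Fin.val_succ, Fin.val_castSucc]
  ring

theorem signedFace_zero (n : ℕ) :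
    signedFace k R n 0 ∘ₗ cyclicOp k R (n + 1) = signedFace k R n (Fin.last (n + 1)) := by
  have : face k 0 ∘ₗ rot k R (n + 1) = face k (Fin.last (n + 1)) :=
    chains_hom_ext fun x => by simp [face_pureTensor, rot_pureTensor, faceTuple_zero_rotTuple]
  rw [signedFace, signedFace, cyclicOp, LinearMap.comp_smul, LinearMap.smul_comp, this]
  simp

theorem hochschildBoundary_eq (n : ℕ) :
    hochschildBoundary k R R n = barBoundary k R R n + signedFace k R n (Fin.last (n + 1)) :=
  Fin.sum_univ_castSucc _

theorem hochschildBoundary_one_sub (n : ℕ) :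
    hochschildBoundary k R R n ∘ₗ (1 - cyclicOp k R (n + 1)) =
      (1 - cyclicOp k R n) ∘ₗ barBoundary k R R n := by
  have h : hochschildBoundary k R R n ∘ₗ cyclicOp k R (n + 1) =
      signedFace k R n (Fin.last (n + 1)) + cyclicOp k R n ∘ₗ barBoundary k R R n := by
    have : hochschildBoundary k R R n =
        signedFace k R n 0 + ∑ i : Fin (n + 1), signedFace k R n i.succ := Fin.sum_univ_succ _
    rw [this, LinearMap.add_comp, signedFace_zero, sum_comp]
    simp only [signedFace_succ, ← comp_sum]
    rfl
  rw [LinearMap.comp_sub, h, LinearMap.sub_comp, hochschildBoundary_eq]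
  simp only [Module.End.one_eq_id, LinearMap.comp_id, LinearMap.id_comp]
  abel

theorem cyclicOp_mul_normOp (n : ℕ) : cyclicOp k R n * normOp k R n = normOp k R n := by
  have := mul_geom_sum (cyclicOp k R n) (n + 1)
  rw [cyclicOp_pow, sub_self, sub_mul, one_mul, sub_eq_zero] at this
  exact this

theorem normOp_mul_cyclicOp (n : ℕ) : normOp k R n * cyclicOp k R n = normOp k R n := by
  have := geom_sum_mul (cyclicOp k R n) (n + 1)
  rw [cyclicOp_pow, sub_self, mul_sub, mul_one, sub_eq_zero] at this
  exact this

theorem signedFace_comp_normOp (n : ℕ) (i : ℕ) (hi : i < n + 2) :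
    signedFace k R n ⟨i, hi⟩ ∘ₗ normOp k R (n + 1) =
      (cyclicOp k R n ^ i) ∘ₗ signedFace k R n 0 ∘ₗ normOp k R (n + 1) := by
  induction i with
  | zero => rfl
  | succ i ih =>
    have h := signedFace_succ k R n ⟨i, by omega⟩
    rw [← cyclicOp_mul_normOp, Module.End.mul_eq_comp, ← LinearMap.comp_assoc]
    rw [Fin.succ_mk, Fin.castSucc_mk] at h
    rw [h, LinearMap.comp_assoc, ih (by omega), pow_succ', Module.End.mul_eq_comp,
      LinearMap.comp_assoc, ← Module.End.mul_eq_comp _ (normOp k R (n + 1)), cyclicOp_mul_normOp]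

theorem normOp_comp_signedFace (n : ℕ) (j : ℕ) (hj : j < n + 2) :
    normOp k R n ∘ₗ signedFace k R n ⟨n + 1 - j, by omega⟩ =
      normOp k R n ∘ₗ signedFace k R n 0 ∘ₗ (cyclicOp k R (n + 1) ^ (j + 1)) := by
  induction j with
  | zero => rw [zero_add, pow_one, signedFace_zero]; rfl
  | succ j ih =>
    have h := signedFace_succ k R n ⟨n - j, by omega⟩
    have e : (⟨n - j, by omega⟩ : Fin (n + 1)).succ = ⟨n + 1 - j, by omega⟩ :=
      Fin.ext (by simp; omega)
    have e' : (⟨n - j, by omega⟩ : Fin (n + 1)).castSucc = ⟨n + 1 - (j + 1), by omega⟩ :=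
      Fin.ext (by simp)
    rw [e, e'] at h
    rw [pow_succ, Module.End.mul_eq_comp, ← LinearMap.comp_assoc, ← LinearMap.comp_assoc,
      LinearMap.comp_assoc _ _ (normOp k R n), ← ih (by omega), LinearMap.comp_assoc, h,
      ← LinearMap.comp_assoc, ← Module.End.mul_eq_comp, normOp_mul_cyclicOp]

theorem barBoundary_comp_normOp (n : ℕ) :
    barBoundary k R R n ∘ₗ normOp k R (n + 1) = normOp k R n ∘ₗ hochschildBoundary k R R n := by
  trans normOp k R n ∘ₗ signedFace k R n 0 ∘ₗ normOp k R (n + 1)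
  · have : barBoundary k R R n = ∑ i : Fin (n + 1), signedFace k R n i.castSucc := rfl
    rw [this, sum_comp, normOp.eq_1 k R n, sum_comp, Finset.sum_range]
    exact Finset.sum_congr rfl fun i _ => signedFace_comp_normOp k R n i (by omega)
  · have : hochschildBoundary k R R n = ∑ i : Fin (n + 2), signedFace k R n i := rfl
    rw [this, comp_sum, ← cyclicOp_mul_normOp k R (n + 1), normOp.eq_1 k R (n + 1),
      Finset.mul_sum, comp_sum, comp_sum, ← Equiv.sum_comp Fin.revPerm, Finset.sum_range]
    refine Finset.sum_congr rfl fun i _ => ?_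
    have := normOp_comp_signedFace k R n i (by omega)
    rw [← pow_succ', ← this]
    congr 2
    refine Fin.ext ?_
    simp only [Fin.revPerm_apply, Fin.val_rev]
    omega

/-- The vertical differential of the cyclic bicomplex in column `p`: it is `b` for even `p` and
`-b'` for odd `p`. -/
def vertical (p n : ℕ) : Chains k R R (n + 1) →ₗ[k] Chains k R R n :=
  if Even p then hochschildBoundary k R R n else -barBoundary k R R n

/-- The horizontal differential of the cyclic bicomplex from column `p ≥ 1` to column `p - 1`, in
row `n`: it is `1 - t` for odd `p` and `N` for even `p`. -/
def horizontal (p n : ℕ) : Module.End k (Chains k R R n) :=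
  if Even p then normOp k R n else 1 - cyclicOp k R n

theorem vertical_comp_vertical (p n : ℕ) : vertical k R p n ∘ₗ vertical k R p (n + 1) = 0 := by
  unfold vertical
  split_ifs
  · exact hochschildBoundary_comp k n
  · rw [LinearMap.neg_comp, LinearMap.comp_neg, barBoundary_comp, neg_zero, neg_zero]

theorem horizontal_comp_horizontal (p n : ℕ) :
    horizontal k R p n ∘ₗ horizontal k R (p + 1) n = 0 := by
  rw [← Module.End.mul_eq_comp]
  by_cases h : Even p <;>
    simp [horizontal, h, Nat.even_add_one, mul_sub, sub_mul, cyclicOp_mul_normOp,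
      normOp_mul_cyclicOp]

theorem vertical_comp_horizontal (p n : ℕ) :
    vertical k R p n ∘ₗ horizontal k R (p + 1) (n + 1) +
      horizontal k R (p + 1) n ∘ₗ vertical k R (p + 1) n = 0 := by
  by_cases h : Even p
  · simp [horizontal, vertical, h, Nat.even_add_one, hochschildBoundary_one_sub,
      LinearMap.comp_neg]
  · simp [horizontal, vertical, h, Nat.even_add_one, barBoundary_comp_normOp, LinearMap.neg_comp]

/-- The total module `⨁_{p + q = n} C_q(R, R)` of the cyclic bicomplex, which has `C_q(R, R)` in
each bidegree `(p, q)` with `p, q ≥ 0`; the component `q` lies in column `p = n - q`. -/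
abbrev CyclicTotal (n : ℕ) : Type (max u v) := (q : Fin (n + 1)) → Chains k R R (q : ℕ)

/-- The total differential, horizontal plus vertical: the component of `d x` in row `q`, which lies
in column `n - q`, receives the vertical differential of the component of `x` in row `q + 1` and the
horizontal differential of the component of `x` in row `q`, column `n + 1 - q`. -/
def cyclicBoundary (n : ℕ) : CyclicTotal k R (n + 1) →ₗ[k] CyclicTotal k R n :=
  LinearMap.pi fun q =>
    vertical k R (n - q) q ∘ₗ LinearMap.proj (φ := fun i : Fin (n + 2) => Chains k R R (i : ℕ)) q.succ +
      horizontal k R (n + 1 - q) q ∘ₗ LinearMap.proj (φ := fun i : Fin (n + 2) => Chains k R R (i : ℕ)) q.castSucc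

theorem cyclicBoundary_comp (n : ℕ) : cyclicBoundary k R n ∘ₗ cyclicBoundary k R (n + 1) = 0 := by
  refine LinearMap.ext fun x => funext fun q => ?_
  have hq : (q : ℕ) ≤ n := by omega
  have e1 : n + 1 - (q + 1) = n - (q : ℕ) := by omega
  have e2 : n + 1 + 1 - (q + 1) = n - (q : ℕ) + 1 := by omega
  have e3 : n + 1 - (q : ℕ) = n - q + 1 := by omega
  have e4 : n + 1 + 1 - (q : ℕ) = n - q + 1 + 1 := by omega
  have h1 := LinearMap.congr_fun (vertical_comp_vertical k R (n - q) q) (x q.succ.succ)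
  have h2 := LinearMap.congr_fun (vertical_comp_horizontal k R (n - q) q) (x q.succ.castSucc)
  have h3 := LinearMap.congr_fun (horizontal_comp_horizontal k R (n - q + 1) q)
    (x q.castSucc.castSucc)
  simp only [LinearMap.comp_apply, LinearMap.add_apply, LinearMap.zero_apply] at h1 h2 h3
  simp only [cyclicBoundary, LinearMap.comp_apply, LinearMap.pi_apply, LinearMap.add_apply,
    LinearMap.proj_apply, map_add, Fin.val_succ, Fin.val_castSucc, e1, e2, e3, e4,
    LinearMap.zero_apply, Pi.zero_apply]
  rw [h1, h3, zero_add, add_zero]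
  exact h2

end Cyclic

/-! ### Hochschild and cyclic homology -/

section Homology

variable {k : Type v} [CommRing k]

section Hochschild

variable {R R' R'' : Type u} [Ring R] [Ring R'] [Ring R''] [Algebra k R] [Algebra k R']
  [Algebra k R'']

/-- The Hochschild complex `(C_•(R, M), b)`. -/
def hochschildComplex (M : Bimodule k R R) : ChainComplex (ModuleCat.{max u v} k) ℕ :=
  ChainComplex.of (fun n => ModuleCat.of k (Chains k R M n))
    (fun n => ModuleCat.ofHom (hochschildBoundary k R M n))
    fun n => by
      rw [← ModuleCat.ofHom_comp, hochschildBoundary_comp]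
      rfl

/-- The Hochschild homology `H_n(R, M)`. -/
def hochschildHomology (n : ℕ) (M : Bimodule k R R) : ModuleCat.{max u v} k :=
  (hochschildComplex M).homology n

/-- The chain map induced by an algebra morphism `f : R → R'` and a morphism `M → M'` over it. -/
def hochschildComplexMap {f : R →ₐ[k] R'} {M : Bimodule k R R} {M' : Bimodule k R' R'}
    (μ : Bimodule.HomOver f f M M') : hochschildComplex M ⟶ hochschildComplex M' :=
  ChainComplex.ofHom (fun n => ModuleCat.ofHom (chainsMap k f μ.toLinearMap n)) fun n => by
    simp only [hochschildComplex, ChainComplex.of_d]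
    erw [← ModuleCat.ofHom_comp, ← ModuleCat.ofHom_comp]
    rw [hochschildBoundary_comp_chainsMap k f _ μ.map_smul μ.map_op_smul]

/-- The induced map `H_n(R, M) → H_n(R', M')`. -/
def hochschildHomologyMap (n : ℕ) {f : R →ₐ[k] R'} {M : Bimodule k R R} {M' : Bimodule k R' R'}
    (μ : Bimodule.HomOver f f M M') : hochschildHomology n M ⟶ hochschildHomology n M' :=
  HomologicalComplex.homologyMap (hochschildComplexMap μ) n

end Hochschild

section CyclicHomology

variable (k) (R : Type u) {R' : Type u} [Ring R] [Ring R'] [Algebra k R] [Algebra k R']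

/-- The total complex of the cyclic bicomplex of `R`. -/
def cyclicComplex : ChainComplex (ModuleCat.{max u v} k) ℕ :=
  ChainComplex.of (fun n => ModuleCat.of k (CyclicTotal k R n))
    (fun n => ModuleCat.ofHom (cyclicBoundary k R n))
    fun n => by
      rw [← ModuleCat.ofHom_comp, cyclicBoundary_comp]
      rfl

/-- The cyclic homology `HC_n(R)`. -/
def cyclicHomology (n : ℕ) : ModuleCat.{max u v} k := (cyclicComplex k R).homology n

variable {k R} (f : R →ₐ[k] R')

theorem cyclicOp_comp_chainsMap (n : ℕ) :
    cyclicOp k R' n ∘ₗ chainsMap k f f.toLinearMap n =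
      chainsMap k f f.toLinearMap n ∘ₗ cyclicOp k R n := by
  have : rot k R' n ∘ₗ chainsMap k f f.toLinearMap n =
      chainsMap k f f.toLinearMap n ∘ₗ rot k R n := chains_hom_ext fun x => by
    simp only [LinearMap.comp_apply, chainsMap_pureTensor, rot_pureTensor]
    congr 1
    cases n with
    | zero => rfl
    | succ n =>
      refine Prod.ext rfl (funext fun j => ?_)
      refine Fin.cases rfl (fun j => rfl) j
  simp only [cyclicOp, LinearMap.smul_comp, LinearMap.comp_smul, this]

theorem normOp_comp_chainsMap (n : ℕ) :
    normOp k R' n ∘ₗ chainsMap k f f.toLinearMap n =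
      chainsMap k f f.toLinearMap n ∘ₗ normOp k R n := by
  have (j : ℕ) : (cyclicOp k R' n ^ j) ∘ₗ chainsMap k f f.toLinearMap n =
      chainsMap k f f.toLinearMap n ∘ₗ (cyclicOp k R n ^ j) := by
    induction j with
    | zero => rfl
    | succ j ih =>
      rw [pow_succ, pow_succ, Module.End.mul_eq_comp, Module.End.mul_eq_comp, LinearMap.comp_assoc,
        cyclicOp_comp_chainsMap, ← LinearMap.comp_assoc, ih, LinearMap.comp_assoc]
  simp only [normOp, sum_comp, comp_sum, this]

theorem horizontal_comp_chainsMap (p n : ℕ) :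
    horizontal k R' p n ∘ₗ chainsMap k f f.toLinearMap n =
      chainsMap k f f.toLinearMap n ∘ₗ horizontal k R p n := by
  unfold horizontal
  split_ifs
  · exact normOp_comp_chainsMap f n
  · rw [LinearMap.sub_comp, LinearMap.comp_sub, cyclicOp_comp_chainsMap]
    rfl

theorem vertical_comp_chainsMap (p n : ℕ) :
    vertical k R' p n ∘ₗ chainsMap k f f.toLinearMap (n + 1) =
      chainsMap k f f.toLinearMap n ∘ₗ vertical k R p n := by
  unfold vertical
  split_ifs
  · exact hochschildBoundary_comp_chainsMap k f f.toLinearMap (fun a x => map_mul f a x)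
      (fun a x => map_mul f x a) n
  · rw [LinearMap.neg_comp, LinearMap.comp_neg,
      barBoundary_comp_chainsMap k f f.toLinearMap (fun a x => map_mul f a x)
      (fun a x => map_mul f x a) n]

/-- The map of total modules induced by an algebra morphism. -/
def cyclicTotalMap (n : ℕ) : CyclicTotal k R n →ₗ[k] CyclicTotal k R' n :=
  LinearMap.pi fun q => chainsMap k f f.toLinearMap q ∘ₗ
    LinearMap.proj (φ := fun i : Fin (n + 1) => Chains k R R (i : ℕ)) q

theorem cyclicBoundary_comp_cyclicTotalMap (n : ℕ) :
    cyclicBoundary k R' n ∘ₗ cyclicTotalMap f (n + 1) =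
      cyclicTotalMap f n ∘ₗ cyclicBoundary k R n := by
  refine LinearMap.ext fun x => funext fun q => ?_
  have h1 := LinearMap.congr_fun (vertical_comp_chainsMap f (n - q) q) (x q.succ)
  have h2 := LinearMap.congr_fun (horizontal_comp_chainsMap f (n + 1 - q) q) (x q.castSucc)
  exact (congrArg₂ (· + ·) h1 h2).trans (map_add (chainsMap k f f.toLinearMap q) _ _).symm

/-- The chain map of cyclic complexes induced by an algebra morphism. -/
def cyclicComplexMap : cyclicComplex k R ⟶ cyclicComplex k R' :=
  ChainComplex.ofHom (fun n => ModuleCat.ofHom (cyclicTotalMap f n)) fun n => by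
    simp only [cyclicComplex, ChainComplex.of_d]
    erw [← ModuleCat.ofHom_comp, ← ModuleCat.ofHom_comp]
    rw [cyclicBoundary_comp_cyclicTotalMap]

/-- The induced map `HC_n(R) → HC_n(R')`. -/
def cyclicHomologyMap (n : ℕ) : cyclicHomology k R n ⟶ cyclicHomology k R' n :=
  HomologicalComplex.homologyMap (cyclicComplexMap f) n

end CyclicHomology

end Homology

end

end MoritaInvariance

open MoritaInvariance

namespace MoritaInvariance

noncomputable section

/-! ### Matrix-valued morphisms and generalized traces -/

/-! The isomorphism is a generalized trace. Write $1_R=\sum_i\psi(q_i\otimes p_i)$. Then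
$r\mapsto(\varphi(p_i\otimes rq_j))_{ij}$ is a multiplicative, usually non-unital map from $R$ to
matrices over $S$, and $m\mapsto(p_i\otimes m\otimes q_j)_{ij}$ is compatible with it (`transfer`,
`transferHom`). Summing over all cycles of indices turns such a pair into a chain map: summing over
the index between two neighbouring factors is matrix multiplication, which is what a face operator
performs (`sum_pureTensor_faceTuple_insertNth`). On algebras the trace also commutes with the cyclic
rotation. A decomposition $1_S=\sum_j\varphi(p'_j\otimes q'_j)$ gives a trace in the other
direction.

Traces compose by taking products of index sets (`traceMap_comp`), and the Morita identities show
that both composites are traces of conjugations $x\mapsto(b_ixa_j)_{ij}$ with $\sum_ia_ib_i=1$. It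
remains to see that conjugations are the identity on homology. Place $A$ in the two diagonal corners
of the $2\times2$ matrices over $A$. The multiplicative map `spread` restricts to the identity on
one corner and to the conjugation on the other, so it suffices that the two corner inclusions agree
on homology. For Hochschild homology an explicit presimplicial homotopy between them does this
(`Intertwiner.exists_boundary`, `exists_boundary_conj`).

This homotopy is not shown to respect the cyclic operator, so cyclic homology needs another
argument. If $G$ is the identity on Hochschild homology, then $1-G$ pushes each cyclic cycle into
lower columns modulo boundaries, since the odd columns are contractible. Hence a cyclic cycle killed
by the trace of $G$ at chain level is a boundary (`ActsTrivially.exists_cyclicBoundary`). For a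
suitable conjugation $G$ of $2\times2$ matrices, this applies to the difference of the two corner
images of a cycle.

Naturality comes from independence of choices. Two transfer isomorphisms built from different
decompositions of $1_R$ share an inverse, which involves only the decomposition of $1_S$, so they
are equal on homology. A morphism of contexts carries a decomposition of $1_R$ to one of $1_{R'}$,
and for this transported decomposition the square commutes on chains. -/

theorem pureTensor_sum {k : Type v} [CommRing k] {R M : Type u} [Ring R] [Algebra k R]
    [AddCommGroup M] [Module k M] {n : ℕ} {ι : Type*} (s : Finset ι) (m : ι → M) (r : Fin n → R) :
    pureTensor k (∑ l ∈ s, m l, r) = ∑ l ∈ s, pureTensor k (m l, r) :=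
  TensorProduct.sum_tmul s m _

theorem pureTensor_update_sum {k : Type v} [CommRing k] {R M : Type u} [Ring R] [Algebra k R]
    [AddCommGroup M] [Module k M] {n : ℕ} {ι : Type*} (s : Finset ι) (m : M) (r : Fin n → R)
    (i : Fin n) (a : ι → R) :
    pureTensor k (m, Function.update r i (∑ l ∈ s, a l)) =
      ∑ l ∈ s, pureTensor k (m, Function.update r i (a l)) := by
  simp only [pureTensor, MultilinearMap.map_update_sum]
  exact TensorProduct.tmul_sum _ _ _

theorem pureTensor_eq_zero_left {k : Type v} [CommRing k] {R M : Type u} [Ring R] [Algebra k R]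
    [AddCommGroup M] [Module k M] {n : ℕ} {x : M × (Fin n → R)} (h : x.1 = 0) :
    pureTensor k x = 0 := by
  simp only [pureTensor, h]
  exact TensorProduct.zero_tmul _ _

theorem pureTensor_eq_zero_right {k : Type v} [CommRing k] {R M : Type u} [Ring R] [Algebra k R]
    [AddCommGroup M] [Module k M] {n : ℕ} {x : M × (Fin n → R)} (i : Fin n) (h : x.2 i = 0) :
    pureTensor k x = 0 := by
  simp only [pureTensor, MultilinearMap.map_coord_zero _ i h]
  exact TensorProduct.tmul_zero _ _

section Trace

variable {k : Type v} [CommRing k] {A B C M N L : Type u} [Ring A] [Ring B] [Ring C]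
  [Algebra k A] [Algebra k B] [Algebra k C] [AddCommGroup M] [Module k M] [AddCommGroup N]
  [Module k N] [AddCommGroup L] [Module k L] {ι κ : Type} [Fintype ι] [Fintype κ]

/-- The summand of the generalized trace of `(m, r₁, …, rₙ)` indexed by a cycle of indices. -/
def traceTuple (f : ι → ι → A →ₗ[k] B) (g : ι → ι → M →ₗ[k] N) {n : ℕ} (I : Fin (n + 1) → ι)
    (x : M × (Fin n → A)) : N × (Fin n → B) :=
  (g (I (Fin.last n)) (I 0) x.1, fun j => f (I j.castSucc) (I j.succ) (x.2 j))

/-- The summand of the generalized trace indexed by a cycle of indices. -/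
def traceTerm (f : ι → ι → A →ₗ[k] B) (g : ι → ι → M →ₗ[k] N) {n : ℕ} (I : Fin (n + 1) → ι) :
    Chains k A M n →ₗ[k] Chains k B N n :=
  TensorProduct.map (M := M) (M₂ := N) (g (I (Fin.last n)) (I 0))
    (PiTensorProduct.map fun j : Fin n => f (I j.castSucc) (I j.succ))

/-- The generalized trace
`m ⊗ r₁ ⊗ ⋯ ⊗ rₙ ↦ ∑ g_{iₙ i₀}(m) ⊗ f_{i₀ i₁}(r₁) ⊗ ⋯ ⊗ f_{iₙ₋₁ iₙ}(rₙ)`. -/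
def traceMap (f : ι → ι → A →ₗ[k] B) (g : ι → ι → M →ₗ[k] N) (n : ℕ) :
    Chains k A M n →ₗ[k] Chains k B N n :=
  ∑ I : Fin (n + 1) → ι, traceTerm f g I

theorem traceMap_pureTensor (f : ι → ι → A →ₗ[k] B) (g : ι → ι → M →ₗ[k] N) {n : ℕ}
    (x : M × (Fin n → A)) :
    traceMap f g n (pureTensor k x) = ∑ I : Fin (n + 1) → ι, pureTensor k (traceTuple f g I x) := by
  refine (LinearMap.sum_apply _ _ _).trans (Finset.sum_congr rfl fun I _ => ?_)
  refine (TensorProduct.map_tmul _ _ x.1 (PiTensorProduct.tprod k x.2)).trans ?_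
  rw [PiTensorProduct.map_tprod]
  rfl

theorem traceMap_comp (f : ι → ι → A →ₗ[k] B) (g : ι → ι → M →ₗ[k] N) (f' : κ → κ → B →ₗ[k] C)
    (g' : κ → κ → N →ₗ[k] L) (n : ℕ) :
    traceMap f' g' n ∘ₗ traceMap f g n =
      traceMap (fun i j : ι × κ => f' i.2 j.2 ∘ₗ f i.1 j.1) (fun i j => g' i.2 j.2 ∘ₗ g i.1 j.1) n :=
  chains_hom_ext fun x => by
    simp only [LinearMap.comp_apply, traceMap_pureTensor, map_sum]
    rw [← (Equiv.arrowProdEquivProdArrow (Fin (n + 1)) (fun _ => ι) (fun _ => κ)).symm.sum_comp,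
      Fintype.sum_prod_type]
    rfl

/-- The trace only sees the indices on which the family is supported. -/
theorem traceMap_eq_of_injective {f : ι → ι → A →ₗ[k] B} {g : ι → ι → M →ₗ[k] N}
    {f' : κ → κ → A →ₗ[k] B} {g' : κ → κ → M →ₗ[k] N} (e : ι → κ) (he : Function.Injective e)
    (hf : ∀ i j, f' (e i) (e j) = f i j) (hg : ∀ i j, g' (e i) (e j) = g i j)
    (hf0 : ∀ i j, i ∉ Set.range e → f' j i = 0)
    (hg0 : ∀ i j, i ∉ Set.range e → g' j i = 0) (n : ℕ) :
    traceMap f' g' n = traceMap f g n :=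
  chains_hom_ext fun x => by
    rw [traceMap_pureTensor, traceMap_pureTensor]
    refine (Finset.sum_of_injOn (fun I => e ∘ I) (he.comp_left.injOn) (by simp) ?_ ?_).symm
    · rintro I - hI
      have : ∃ a, I a ∉ Set.range e := by
        by_contra! h
        choose J hJ using h
        exact hI ⟨J, by simp, funext hJ⟩
      obtain ⟨a, ha⟩ := this
      -- Each position of the cycle occurs exactly once as a second index: position 0 in the
      -- coefficient, position `a + 1` in the `a`-th algebra factor. Vanishing in the second index
      -- alone therefore kills the summand.
      obtain rfl | ⟨a, rfl⟩ := Fin.eq_zero_or_eq_succ a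
      · exact pureTensor_eq_zero_left (by simp [traceTuple, hg0 _ _ ha])
      · exact pureTensor_eq_zero_right a (by simp [traceTuple, hf0 _ _ ha])
    · rintro I -
      simp [traceTuple, hf, hg]

theorem chainsMap_comp_traceMap {A' B' M' N' : Type u} [Ring A'] [Ring B'] [Algebra k A']
    [Algebra k B'] [AddCommGroup M'] [Module k M'] [AddCommGroup N'] [Module k N']
    {f : ι → ι → A →ₗ[k] B} {g : ι → ι → M →ₗ[k] N} {f' : ι → ι → A' →ₗ[k] B'}
    {g' : ι → ι → M' →ₗ[k] N'} (α : A →ₐ[k] A') (β : B →ₐ[k] B') (μ : M →ₗ[k] M')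
    (ν : N →ₗ[k] N') (hf : ∀ i j a, β (f i j a) = f' i j (α a))
    (hg : ∀ i j m, ν (g i j m) = g' i j (μ m)) (n : ℕ) :
    chainsMap k β ν n ∘ₗ traceMap f g n = traceMap f' g' n ∘ₗ chainsMap k α μ n :=
  chains_hom_ext fun x => by
    simp only [LinearMap.comp_apply, traceMap_pureTensor, map_sum, chainsMap_pureTensor, traceTuple,
      hf, hg]

/-- A multiplicative, not necessarily unital, morphism from `A` to matrices over `B`. -/
structure MatAlgHom (k : Type v) [CommRing k] (ι : Type) [Fintype ι] (A B : Type u) [Ring A]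
    [Ring B] [Algebra k A] [Algebra k B] where
  entry : ι → ι → A →ₗ[k] B
  entry_mul : ∀ i j x y, entry i j (x * y) = ∑ l, entry i l x * entry l j y

/-- A morphism from a bimodule `M` to matrices over `N`, along a morphism `F`. -/
structure MatHom (F : MatAlgHom k ι A B) (M N : Type u) [AddCommGroup M] [Module k M]
    [AddCommGroup N] [Module k N] [Module A M] [Module Aᵐᵒᵖ M] [Module B N] [Module Bᵐᵒᵖ N] where
  entry : ι → ι → M →ₗ[k] N
  entry_smul : ∀ i j (x : A) m, entry i j (x • m) = ∑ l, F.entry i l x • entry l j m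
  entry_op_smul : ∀ i j (x : A) m,
    entry i j (op x • m) = ∑ l, op (F.entry l j x) • entry i l m

/-- A matrix-valued algebra morphism as a morphism of bimodules. -/
def MatAlgHom.self (F : MatAlgHom k ι A B) : MatHom F A B where
  entry := F.entry
  entry_smul i j x m := by simp [F.entry_mul]
  entry_op_smul i j x m := by simp [F.entry_mul]

/-- Phrasing the insertion by comparing values in `ℕ` lets the face identities below be settled by
case splits and `omega`. -/
theorem insertNth_apply_val {T : Type*} {n : ℕ} (i : Fin (n + 1)) (l : T) (I : Fin n → T)
    (a : Fin (n + 1)) : (i.insertNth l I : Fin (n + 1) → T) a =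
      if h : (a : ℕ) < i then I ⟨a, by omega⟩ else
        if h' : (a : ℕ) = i then l else I ⟨a - 1, by omega⟩ := by
  rcases lt_trichotomy a i with h | h | h
  · rw [Fin.insertNth_apply_below h, dif_pos (Fin.lt_def.1 h), eq_rec_constant]
    rfl
  · subst h
    simp
  · have h1 := Fin.lt_def.1 h
    rw [Fin.insertNth_apply_above h, dif_neg (by omega), dif_neg (by omega), eq_rec_constant]
    rfl

variable [Module A M] [Module Aᵐᵒᵖ M] [Module B N] [Module Bᵐᵒᵖ N]

/-- The `i`-th face merges the two entries that share the `i`-th index of the cycle, so summing over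
that index is a matrix product. It is the right action on the coefficient for `i = 0`, the left
action for `i = n + 1`, and the product in the algebra otherwise. Unitality plays no role. -/
theorem sum_pureTensor_faceTuple_insertNth {F : MatAlgHom k ι A B} (μ : MatHom F M N) {n : ℕ}
    (i : Fin (n + 2)) (x : M × (Fin (n + 1) → A)) (I : Fin (n + 1) → ι) :
    ∑ l, pureTensor k (faceTuple i (traceTuple F.entry μ.entry (i.insertNth l I) x)) =
      pureTensor k (traceTuple F.entry μ.entry I (faceTuple i x)) := by
  obtain ⟨i, hi⟩ := i
  obtain ⟨m, r⟩ := x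
  by_cases h0 : i = 0
  · subst h0
    have e1 : (traceTuple F.entry μ.entry I (faceTuple ⟨0, hi⟩ (m, r))) =
        (∑ l, op (F.entry l (I 0) (r 0)) • μ.entry (I (Fin.last n)) l m,
          (traceTuple F.entry μ.entry I (faceTuple ⟨0, hi⟩ (m, r))).2) := by
      refine Prod.ext ?_ rfl
      simp [traceTuple, faceTuple, μ.entry_op_smul]
    rw [e1, pureTensor_sum]
    refine Finset.sum_congr rfl fun l _ => congrArg _ (Prod.ext ?_ (funext fun j => ?_))
    · simp [traceTuple, faceTuple, insertNth_apply_val]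
      rfl
    · simp [traceTuple, faceTuple, insertNth_apply_val]
      rfl
  by_cases h1 : i = n + 1
  · subst h1
    have e1 : (traceTuple F.entry μ.entry I (faceTuple ⟨n + 1, hi⟩ (m, r))) =
        (∑ l, F.entry (I (Fin.last n)) l (r (Fin.last n)) • μ.entry l (I 0) m,
          (traceTuple F.entry μ.entry I (faceTuple ⟨n + 1, hi⟩ (m, r))).2) := by
      refine Prod.ext ?_ rfl
      simp [traceTuple, faceTuple, μ.entry_smul]
    rw [e1, pureTensor_sum]
    refine Finset.sum_congr rfl fun l _ => congrArg _ (Prod.ext ?_ (funext fun j => ?_))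
    · simp [traceTuple, faceTuple, insertNth_apply_val]
    · simp [traceTuple, faceTuple, insertNth_apply_val]
      rfl
  · obtain ⟨s, rfl⟩ := Nat.exists_eq_succ_of_ne_zero h0
    have hs : s < n := by omega
    -- Only slot `s` carries the merged product; writing it as an update makes multilinearity in
    -- that slot available.
    have e1 : (traceTuple F.entry μ.entry I (faceTuple ⟨s + 1, hi⟩ (m, r))) =
        ((traceTuple F.entry μ.entry I (faceTuple ⟨s + 1, hi⟩ (m, r))).1,
          Function.update (traceTuple F.entry μ.entry I (faceTuple ⟨s + 1, hi⟩ (m, r))).2 ⟨s, hs⟩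
            (∑ l, F.entry (I ⟨s, by omega⟩) l (r ⟨s, by omega⟩) *
              F.entry l (I ⟨s + 1, by omega⟩) (r ⟨s + 1, by omega⟩))) := by
      refine Prod.ext rfl ?_
      rw [eq_comm, Function.update_eq_self_iff]
      simp [traceTuple, faceTuple, F.entry_mul]
    rw [e1, pureTensor_update_sum]
    refine Finset.sum_congr rfl fun l _ => congrArg _ (Prod.ext ?_ (funext fun j => ?_))
    · have h2 : ¬ n + 1 < s + 1 := by omega
      have h3 : ¬ n = s := by omega
      simp [traceTuple, faceTuple, insertNth_apply_val, hs.ne, h2, h3]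
      rfl
    · obtain ⟨j, hj⟩ := j
      simp only [traceTuple, faceTuple, insertNth_apply_val, Function.update_apply, Fin.mk.injEq,
        Fin.castSucc_mk, Fin.succ_mk]
      split_ifs <;> first | rfl | omega | (subst_vars; rfl)

variable [IsScalarTower k A M] [IsScalarTower k Aᵐᵒᵖ M] [IsScalarTower k B N]
  [IsScalarTower k Bᵐᵒᵖ N]

theorem face_comp_traceMap {F : MatAlgHom k ι A B} (μ : MatHom F M N) {n : ℕ} (i : Fin (n + 2)) :
    face k i ∘ₗ traceMap F.entry μ.entry (n + 1) = traceMap F.entry μ.entry n ∘ₗ face k i :=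
  chains_hom_ext fun x => by
    simp only [LinearMap.comp_apply, traceMap_pureTensor, map_sum, face_pureTensor]
    -- A cycle of `n + 2` indices is a cycle of `n + 1` indices together with the one inserted at
    -- position `i`.
    rw [← (Fin.insertNthEquiv (fun _ => ι) i).sum_comp, Fintype.sum_prod_type_right]
    exact Finset.sum_congr rfl fun I _ => sum_pureTensor_faceTuple_insertNth μ i x I

theorem hochschildBoundary_comp_traceMap {F : MatAlgHom k ι A B} (μ : MatHom F M N) (n : ℕ) :
    hochschildBoundary k B N n ∘ₗ traceMap F.entry μ.entry (n + 1) =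
      traceMap F.entry μ.entry n ∘ₗ hochschildBoundary k A M n := by
  simp only [hochschildBoundary, sum_comp, comp_sum, LinearMap.smul_comp, LinearMap.comp_smul,
    face_comp_traceMap]

theorem barBoundary_comp_traceMap {F : MatAlgHom k ι A B} (μ : MatHom F M N) (n : ℕ) :
    barBoundary k B N n ∘ₗ traceMap F.entry μ.entry (n + 1) =
      traceMap F.entry μ.entry n ∘ₗ barBoundary k A M n := by
  simp only [barBoundary, sum_comp, comp_sum, LinearMap.smul_comp, LinearMap.comp_smul,
    face_comp_traceMap]

end Trace

/-! ### Generalized traces on the cyclic bicomplex -/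

section CyclicTrace

variable {k : Type v} [CommRing k] {A B : Type u} [Ring A] [Ring B] [Algebra k A] [Algebra k B]
  {ι : Type} [Fintype ι]

/-- With the same family on the coefficient and on the other factors, the trace is a sum over closed
cycles, and rotating the tensor factors only rotates the cycle of indices. -/
theorem rot_comp_traceMap (f : ι → ι → A →ₗ[k] B) (n : ℕ) :
    rot k B n ∘ₗ traceMap f f n = traceMap f f n ∘ₗ rot k A n :=
  chains_hom_ext fun x => by
    simp only [LinearMap.comp_apply, traceMap_pureTensor, map_sum, rot_pureTensor]
    cases n with
    | zero => rfl
    | succ n =>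
      rw [← ((finRotate (n + 2)).symm.arrowCongr (Equiv.refl ι)).sum_comp]
      refine Finset.sum_congr rfl fun I _ => congrArg _ (Prod.ext ?_ (funext fun j => ?_))
      · simp [traceTuple, rotTuple]
      · refine Fin.cases ?_ (fun j => ?_) j
        · simp [traceTuple, rotTuple]
        · simp [traceTuple, rotTuple]
          rw [Fin.succ_castSucc, Fin.coeSucc_eq_succ]

theorem cyclicOp_comp_traceMap (f : ι → ι → A →ₗ[k] B) (n : ℕ) :
    cyclicOp k B n ∘ₗ traceMap f f n = traceMap f f n ∘ₗ cyclicOp k A n := by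
  simp only [cyclicOp, LinearMap.smul_comp, LinearMap.comp_smul, rot_comp_traceMap]

theorem normOp_comp_traceMap (f : ι → ι → A →ₗ[k] B) (n : ℕ) :
    normOp k B n ∘ₗ traceMap f f n = traceMap f f n ∘ₗ normOp k A n := by
  have (j : ℕ) : (cyclicOp k B n ^ j) ∘ₗ traceMap f f n =
      traceMap f f n ∘ₗ (cyclicOp k A n ^ j) := by
    induction j with
    | zero => rfl
    | succ j ih =>
      rw [pow_succ, pow_succ, Module.End.mul_eq_comp, Module.End.mul_eq_comp, LinearMap.comp_assoc,
        cyclicOp_comp_traceMap, ← LinearMap.comp_assoc, ih, LinearMap.comp_assoc]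
  simp only [normOp, sum_comp, comp_sum, this]

theorem horizontal_comp_traceMap (f : ι → ι → A →ₗ[k] B) (p n : ℕ) :
    horizontal k B p n ∘ₗ traceMap f f n = traceMap f f n ∘ₗ horizontal k A p n := by
  unfold horizontal
  split_ifs
  · exact normOp_comp_traceMap f n
  · rw [LinearMap.sub_comp, LinearMap.comp_sub, cyclicOp_comp_traceMap]
    rfl

theorem vertical_comp_traceMap (F : MatAlgHom k ι A B) (p n : ℕ) :
    vertical k B p n ∘ₗ traceMap F.entry F.entry (n + 1) =
      traceMap F.entry F.entry n ∘ₗ vertical k A p n := by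
  unfold vertical
  split_ifs
  · exact hochschildBoundary_comp_traceMap F.self n
  · rw [LinearMap.neg_comp, LinearMap.comp_neg]
    exact congrArg _ (barBoundary_comp_traceMap F.self n)

/-- The map of total modules induced by a generalized trace. -/
def cyclicTotalTrace (f : ι → ι → A →ₗ[k] B) (n : ℕ) : CyclicTotal k A n →ₗ[k] CyclicTotal k B n :=
  LinearMap.pi fun q => traceMap f f q ∘ₗ
    LinearMap.proj (φ := fun i : Fin (n + 1) => Chains k A A (i : ℕ)) q

theorem cyclicBoundary_comp_cyclicTotalTrace (F : MatAlgHom k ι A B) (n : ℕ) :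
    cyclicBoundary k B n ∘ₗ cyclicTotalTrace F.entry (n + 1) =
      cyclicTotalTrace F.entry n ∘ₗ cyclicBoundary k A n := by
  refine LinearMap.ext fun x => funext fun q => ?_
  have h1 := LinearMap.congr_fun (vertical_comp_traceMap F (n - q) q) (x q.succ)
  have h2 := LinearMap.congr_fun (horizontal_comp_traceMap F.entry (n + 1 - q) q) (x q.castSucc)
  exact (congrArg₂ (· + ·) h1 h2).trans (map_add (traceMap F.entry F.entry q) _ _).symm

end CyclicTrace

/-! ### The chain maps induced by generalized traces -/

section Complexes

variable {k : Type v} [CommRing k] {A B C : Type u} [Ring A] [Ring B] [Ring C] [Algebra k A]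
  [Algebra k B] [Algebra k C] {ι κ : Type} [Fintype ι] [Fintype κ]

/-- The map of Hochschild complexes given by the generalized trace. -/
def hochschildTrace {F : MatAlgHom k ι A B} {M : Bimodule k A A} {N : Bimodule k B B}
    (μ : MatHom F M N) : hochschildComplex M ⟶ hochschildComplex N :=
  ChainComplex.ofHom (fun n => ModuleCat.ofHom (traceMap F.entry μ.entry n)) fun n => by
    simp only [hochschildComplex, ChainComplex.of_d]
    erw [← ModuleCat.ofHom_comp, ← ModuleCat.ofHom_comp]
    rw [hochschildBoundary_comp_traceMap]

/-- The map of cyclic complexes given by the generalized trace. -/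
def cyclicTrace (F : MatAlgHom k ι A B) : cyclicComplex k A ⟶ cyclicComplex k B :=
  ChainComplex.ofHom (fun n => ModuleCat.ofHom (cyclicTotalTrace F.entry n)) fun n => by
    simp only [cyclicComplex, ChainComplex.of_d]
    erw [← ModuleCat.ofHom_comp, ← ModuleCat.ofHom_comp]
    rw [cyclicBoundary_comp_cyclicTotalTrace]

theorem hochschildComplex_hom_ext {R S : Type u} [Ring R] [Ring S] [Algebra k R] [Algebra k S]
    {M : Bimodule k R R} {N : Bimodule k S S} {φ ψ : hochschildComplex M ⟶ hochschildComplex N}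
    (h : ∀ (n : ℕ) (z : Chains k R M n), φ.f n z = ψ.f n z) : φ = ψ :=
  HomologicalComplex.hom_ext _ _ fun n => ModuleCat.hom_ext (LinearMap.ext (h n))

theorem cyclicComplex_hom_ext {φ ψ : cyclicComplex k A ⟶ cyclicComplex k B}
    (h : ∀ (n : ℕ) (z : CyclicTotal k A n), φ.f n z = ψ.f n z) : φ = ψ :=
  HomologicalComplex.hom_ext _ _ fun n => ModuleCat.hom_ext (LinearMap.ext (h n))

/-- A chain map that sends cycles to boundaries is zero on homology. -/
theorem homologyMap_eq_zero {R : Type*} [Ring R] {K L : ChainComplex (ModuleCat R) ℕ}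
    (φ : K ⟶ L) (n : ℕ)
    (h : ∀ z : K.X n, (∀ j, K.d n j z = 0) → ∃ w : L.X (n + 1), L.d (n + 1) n w = φ.f n z) :
    HomologicalComplex.homologyMap φ n = 0 := by
  rw [← cancel_epi (K.homologyπ n), HomologicalComplex.homologyπ_naturality, Limits.comp_zero]
  ext c
  obtain ⟨w, hw⟩ := h (K.iCycles n c) fun j => by
    rw [← ConcreteCategory.comp_apply, HomologicalComplex.iCycles_d]
    rfl
  have e : HomologicalComplex.cyclesMap φ n c = L.toCycles (n + 1) n w := by
    apply (ModuleCat.mono_iff_injective (L.iCycles n)).1 inferInstance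
    rw [← ConcreteCategory.comp_apply, ← ConcreteCategory.comp_apply,
      HomologicalComplex.cyclesMap_i, HomologicalComplex.toCycles_i, hw]
    rfl
  rw [ConcreteCategory.comp_apply, e, ← ConcreteCategory.comp_apply,
    HomologicalComplex.toCycles_comp_homologyπ]
  rfl

theorem homologyMap_eq {R : Type*} [Ring R] {K L : ChainComplex (ModuleCat R) ℕ}
    (φ ψ : K ⟶ L) (n : ℕ)
    (h : ∀ z : K.X n, (∀ j, K.d n j z = 0) →
      ∃ w : L.X (n + 1), L.d (n + 1) n w = φ.f n z - ψ.f n z) :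
    HomologicalComplex.homologyMap φ n = HomologicalComplex.homologyMap ψ n := by
  rw [← sub_eq_zero, ← HomologicalComplex.homologyMap_sub]
  exact homologyMap_eq_zero _ n h

end Complexes

/-! ### A presimplicial homotopy -/

/-- The signed sum of the terms of a presimplicial homotopy. -/
theorem alternating_homotopy_sum {Z : Type*} [AddCommGroup Z] {n : ℕ}
    (D : Fin (n + 2) → Fin (n + 1) → Z) (E : Fin n → Fin (n + 1) → Z) (K : Fin (n + 2) → Z)
    (hK : ∀ j, D j.castSucc j = K j.castSucc) (hK' : ∀ j, D j.succ j = K j.succ)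
    (hE : ∀ i j, i ≤ j.castSucc → D i.castSucc j.succ = E j i)
    (hE' : ∀ i j, j.castSucc < i → D i.succ j.castSucc = E j i) :
    ∑ j : Fin (n + 1), ∑ i : Fin (n + 2), ((-1 : ℤ) ^ (j : ℕ) * (-1) ^ (i : ℕ)) • D i j =
      K 0 - K (Fin.last _) -
        ∑ i : Fin (n + 1), ∑ j : Fin n, ((-1 : ℤ) ^ (j : ℕ) * (-1) ^ (i : ℕ)) • E j i := by
  -- The terms `D i j` with `i = j` are split off first, then in `h2` those with `i = j + 1`. They
  -- carry opposite signs and telescope to `K 0 - K (Fin.last _)`; the remaining terms are values of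
  -- `E`, with one extra sign.
  have h1 (j : Fin (n + 1)) :
      ∑ i : Fin (n + 2), ((-1 : ℤ) ^ (j : ℕ) * (-1) ^ (i : ℕ)) • D i j =
      K j.castSucc + ∑ i : Fin (n + 1), ((-1 : ℤ) ^ (j : ℕ) *
        (-1) ^ (j.castSucc.succAbove i : ℕ)) • D (j.castSucc.succAbove i) j := by
    rw [Fin.sum_univ_succAbove _ j.castSucc, hK, Fin.val_castSucc, ← mul_pow]
    simp
  have h2 (i : Fin (n + 1)) : ∑ j : Fin (n + 1), ((-1 : ℤ) ^ (j : ℕ) *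
        (-1) ^ (j.castSucc.succAbove i : ℕ)) • D (j.castSucc.succAbove i) j =
      - K i.succ - ∑ j : Fin n, ((-1 : ℤ) ^ (j : ℕ) * (-1) ^ (i : ℕ)) • E j i := by
    rw [Fin.sum_univ_succAbove _ i, Fin.succAbove_castSucc_self, hK', Fin.val_succ, pow_succ,
      ← mul_assoc, ← mul_pow, sub_eq_add_neg, ← Finset.sum_neg_distrib]
    congr 1
    · simp
    · refine Finset.sum_congr rfl fun j _ => ?_
      rcases lt_or_ge j.castSucc i with h | h
      · rw [Fin.succAbove_of_castSucc_lt _ _ h, Fin.succAbove_of_le_castSucc _ _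
          (Fin.castSucc_le_castSucc_iff.2 h.le), hE' _ _ h, ← neg_smul]
        simp [pow_succ]
      · rw [Fin.succAbove_of_le_castSucc _ _ h, Fin.succAbove_of_castSucc_lt _ _
          (Fin.castSucc_lt_castSucc_iff.2 (lt_of_le_of_lt h (Fin.castSucc_lt_succ))), hE _ _ h,
          ← neg_smul]
        simp [pow_succ]
  simp only [h1]
  rw [Finset.sum_add_distrib, Finset.sum_comm]
  simp only [h2]
  rw [Finset.sum_sub_distrib, Finset.sum_neg_distrib]
  have h3 := (Fin.sum_univ_succ K).symm.trans (Fin.sum_univ_castSucc K)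
  rw [eq_sub_of_add_eq h3.symm]
  abel

section Homotopy

variable {k : Type v} [CommRing k] {A B M N : Type u} [Ring A] [Ring B]
  [Algebra k A] [Algebra k B] [AddCommGroup M] [Module k M] [AddCommGroup N]
  [Module k N]

/-- The operator inserting a fixed algebra element at the `j`-th place. -/
def insertChain {n : ℕ} (j : Fin (n + 1)) (b : B) : Chains k B N n →ₗ[k] Chains k B N (n + 1) :=
  chainsLift
    { toFun := fun m => MultilinearMap.mk' (fun r => pureTensor k (m, j.insertNth b r))
        (fun r a c c' => by simp [Fin.insertNth_update, pureTensor_update_add])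
        (fun r a t c => by simp [Fin.insertNth_update, pureTensor_update_smul])
      map_add' := fun m m' => by
        ext r
        exact pureTensor_add k m m' _
      map_smul' := fun t m => by
        ext r
        exact pureTensor_smul k t m _ }

theorem insertChain_pureTensor {n : ℕ} (j : Fin (n + 1)) (b : B) (x : N × (Fin n → B)) :
    insertChain j b (pureTensor k x) = pureTensor k (x.1, j.insertNth b x.2) :=
  chainsLift_pureTensor _ _

variable (k A B M N) in
/-- Two multiplicative maps `f₀`, `f₁ : A → B` with compatible maps of bimodules, related by
elements `u`, `v` as in `f₁ = v f₀ u`. -/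
structure Intertwiner [Module A M] [Module Aᵐᵒᵖ M] [Module B N] [Module Bᵐᵒᵖ N] where
  f₀ : A →ₗ[k] B
  f₁ : A →ₗ[k] B
  μ₀ : M →ₗ[k] N
  μ₁ : M →ₗ[k] N
  u : B
  v : B
  f₀_mul : ∀ x y, f₀ (x * y) = f₀ x * f₀ y
  f₁_mul : ∀ x y, f₁ (x * y) = f₁ x * f₁ y
  μ₀_smul : ∀ (x : A) m, μ₀ (x • m) = f₀ x • μ₀ m
  μ₀_op_smul : ∀ (x : A) m, op u • μ₀ (op x • m) = op (f₁ x) • op u • μ₀ m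
  f₁_mul_v : ∀ x, f₁ x * v = v * f₀ x
  op_v_smul : ∀ m, op v • op u • μ₀ m = μ₀ m
  v_smul : ∀ m, v • op u • μ₀ m = μ₁ m

namespace Intertwiner

variable [Module A M] [Module Aᵐᵒᵖ M] [Module B N] [Module Bᵐᵒᵖ N]
  (H : Intertwiner k A B M N)

/-- The tuple `(μ₀(m) u, f₁(r₁), …, f₁(rⱼ), v, f₀(rⱼ₊₁), …, f₀(rₙ))`. -/
def homotopyTuple {n : ℕ} (j : Fin (n + 1)) (x : M × (Fin n → A)) : N × (Fin (n + 1) → B) :=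
  (op H.u • H.μ₀ x.1,
    j.insertNth H.v fun l => if (l : ℕ) < j then H.f₁ (x.2 l) else H.f₀ (x.2 l))

theorem homotopyTuple_snd {n : ℕ} (j : Fin (n + 1)) (x : M × (Fin n → A)) (a : Fin (n + 1)) :
    (H.homotopyTuple j x).2 a =
      if h : (a : ℕ) < j then H.f₁ (x.2 ⟨a, by omega⟩) else
        if h' : (a : ℕ) = j then H.v else H.f₀ (x.2 ⟨a - 1, by omega⟩) := by
  simp only [homotopyTuple, insertNth_apply_val]
  split_ifs <;> first | rfl | omega

/-- One end of the homotopy: $\mu_0(m)uv=\mu_0(m)$ restores the first map. The next lemma is the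
other end, where $v\mu_0(m)u=\mu_1(m)$ gives the second map. -/
theorem faceTuple_zero_homotopyTuple {n : ℕ} (x : M × (Fin n → A)) :
    faceTuple 0 (H.homotopyTuple 0 x) = (H.μ₀ x.1, fun l => H.f₀ (x.2 l)) := by
  refine Prod.ext ?_ (funext fun a => ?_)
  · simp [faceTuple, homotopyTuple, H.op_v_smul]
  · simp [faceTuple, homotopyTuple]

theorem faceTuple_last_homotopyTuple {n : ℕ} (x : M × (Fin n → A)) :
    faceTuple (Fin.last _) (H.homotopyTuple (Fin.last _) x) =
      (H.μ₁ x.1, fun l => H.f₁ (x.2 l)) := by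
  refine Prod.ext ?_ (funext fun a => ?_)
  · simp [faceTuple, homotopyTuple, H.v_smul]
  · simp [faceTuple, homotopyTuple]

/-- Neighbouring terms share a face because $f_1(r)v=vf_0(r)$: the element $v$ may be absorbed from
either side. These are the faces that telescope. -/
theorem faceTuple_homotopyTuple_succ {n : ℕ} (j : Fin n) (x : M × (Fin n → A)) :
    faceTuple j.succ.castSucc (H.homotopyTuple j.succ x) =
      faceTuple j.succ.castSucc (H.homotopyTuple j.castSucc x) := by
  obtain ⟨j, hj⟩ := j
  refine Prod.ext ?_ (funext fun a => ?_)
  · simp [faceTuple, homotopyTuple, hj.ne]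
  · obtain ⟨a, ha⟩ := a
    simp only [faceTuple, homotopyTuple, insertNth_apply_val, Fin.castSucc_mk, Fin.succ_mk]
    split_ifs <;> first | rfl | omega | (subst_vars; exact H.f₁_mul_v _)

/-- The face acts to the left of $v$, where $f_1$ is multiplicative; for the face 0 this is
$\mu_0(mx)u=\mu_0(m)uf_1(x)$. -/
theorem faceTuple_castSucc_homotopyTuple_succ {n : ℕ} (i : Fin (n + 2))
    (j : Fin (n + 1)) (h : i ≤ j.castSucc) (x : M × (Fin (n + 1) → A)) :
    faceTuple i.castSucc (H.homotopyTuple j.succ x) = H.homotopyTuple j (faceTuple i x) := by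
  obtain ⟨i, hi⟩ := i
  obtain ⟨j, hj⟩ := j
  replace h : i ≤ j := h
  refine Prod.ext ?_ (funext fun a => ?_)
  · rcases Nat.eq_zero_or_pos i with rfl | h0
    · simp [faceTuple, homotopyTuple, H.μ₀_op_smul, insertNth_apply_val]
    · have h1 : i ≠ 0 := by omega
      have h2 : i ≠ n + 1 := by omega
      have h3 : i ≠ n + 2 := by omega
      simp [faceTuple, homotopyTuple, h1, h2, h3]
  · obtain ⟨a, ha⟩ := a
    rw [homotopyTuple_snd]
    simp only [faceTuple, homotopyTuple_snd, Fin.castSucc_mk, Fin.succ_mk]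
    rcases Nat.eq_zero_or_pos a with rfl | h0
    · split_ifs <;> first | rfl | omega | exact (H.f₁_mul _ _).symm
    · obtain ⟨a, rfl⟩ := Nat.exists_eq_succ_of_ne_zero h0.ne'
      simp only [Nat.succ_eq_add_one, Nat.add_sub_cancel]
      split_ifs <;> first | rfl | omega | exact (H.f₁_mul _ _).symm

/-- The face acts to the right of $v$, where $f_0$ is multiplicative. The last face multiplies the
coefficient on the left, so it commutes with the right multiplication by $u$. -/
theorem faceTuple_succ_homotopyTuple_castSucc [SMulCommClass B Bᵐᵒᵖ N] {n : ℕ} (i : Fin (n + 2))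
    (j : Fin (n + 1)) (h : j.castSucc < i) (x : M × (Fin (n + 1) → A)) :
    faceTuple i.succ (H.homotopyTuple j.castSucc x) = H.homotopyTuple j (faceTuple i x) := by
  obtain ⟨i, hi⟩ := i
  obtain ⟨j, hj⟩ := j
  replace h : j < i := h
  refine Prod.ext ?_ (funext fun a => ?_)
  · have h1 : i ≠ 0 := by omega
    by_cases h2 : i = n + 1
    · subst h2
      have h3 : ¬ n + 1 < j := by omega
      have h4 : ¬ n + 1 = j := by omega
      have h5 : ¬ n < j := by omega
      simp [faceTuple, homotopyTuple, insertNth_apply_val, H.μ₀_smul, h3, h4, h5,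
        smul_comm _ (op H.u)]
      rfl
    · simp [faceTuple, homotopyTuple, h1, h2]
  · obtain ⟨a, ha⟩ := a
    rw [homotopyTuple_snd]
    simp only [faceTuple, homotopyTuple_snd, Fin.castSucc_mk, Fin.succ_mk]
    rcases Nat.eq_zero_or_pos a with rfl | h0
    · split_ifs <;> first | rfl | omega
    · obtain ⟨a, rfl⟩ := Nat.exists_eq_succ_of_ne_zero h0.ne'
      simp only [Nat.succ_eq_add_one, Nat.add_sub_cancel]
      split_ifs <;> first | rfl | omega | exact (H.f₀_mul _ _).symm

variable [IsScalarTower k Bᵐᵒᵖ N]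

/-- The operator `m ⊗ r₁ ⊗ ⋯ ⊗ rₙ ↦ μ₀(m) u ⊗ f₁(r₁) ⊗ ⋯ ⊗ f₁(rⱼ) ⊗ v ⊗ f₀(rⱼ₊₁) ⊗ ⋯ ⊗ f₀(rₙ)`. -/
def homotopyTerm {n : ℕ} (j : Fin (n + 1)) : Chains k A M n →ₗ[k] Chains k B N (n + 1) :=
  insertChain j H.v ∘ₗ TensorProduct.map (M := M) (M₂ := N) (Algebra.lsmul k k N (op H.u) ∘ₗ H.μ₀)
    (PiTensorProduct.map fun l : Fin n => if (l : ℕ) < j then H.f₁ else H.f₀)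

theorem homotopyTerm_pureTensor {n : ℕ} (j : Fin (n + 1)) (x : M × (Fin n → A)) :
    H.homotopyTerm j (pureTensor k x) = pureTensor k (H.homotopyTuple j x) := by
  refine (congrArg (insertChain j H.v) ((TensorProduct.map_tmul _ _ x.1
    (PiTensorProduct.tprod k x.2)).trans (congrArg _ (PiTensorProduct.map_tprod _ _)))).trans
      ((insertChain_pureTensor j H.v (op H.u • H.μ₀ x.1,
        fun l => (if (l : ℕ) < j then H.f₁ else H.f₀) (x.2 l))).trans ?_)
  simp only [homotopyTuple]
  congr 3
  funext l
  split_ifs <;> rfl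

end Intertwiner

/-- A Hochschild chain is a cycle if it has degree zero or zero boundary. -/
def IsHochschildCycle (k : Type v) [CommRing k] {A M : Type u} [Ring A] [Algebra k A]
    [AddCommGroup M] [Module k M] [Module A M] [Module Aᵐᵒᵖ M] [IsScalarTower k A M]
    [IsScalarTower k Aᵐᵒᵖ M] : {n : ℕ} → Chains k A M n → Prop
  | 0, _ => True
  | n + 1, z => hochschildBoundary k A M n z = 0

theorem traceMap_unit_pureTensor (f : Unit → Unit → A →ₗ[k] B) (g : Unit → Unit → M →ₗ[k] N) {n : ℕ}
    (x : M × (Fin n → A)) : traceMap f g n (pureTensor k x) =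
      pureTensor k (g () () x.1, fun j => f () () (x.2 j)) := by
  rw [traceMap_pureTensor, Fintype.sum_unique]
  rfl

/-- The two maps on chains given by an intertwiner differ by a boundary on cycles. -/
theorem Intertwiner.exists_boundary [Module A M] [Module Aᵐᵒᵖ M] [Module B N] [Module Bᵐᵒᵖ N]
    [IsScalarTower k A M] [IsScalarTower k Aᵐᵒᵖ M] [IsScalarTower k B N] [IsScalarTower k Bᵐᵒᵖ N]
    [SMulCommClass B Bᵐᵒᵖ N] (H : Intertwiner k A B M N) {n : ℕ} (z : Chains k A M n)
    (hz : IsHochschildCycle k z) : ∃ w, hochschildBoundary k B N n w =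
      traceMap (fun _ _ : Unit => H.f₀) (fun _ _ => H.μ₀) n z -
        traceMap (fun _ _ : Unit => H.f₁) (fun _ _ => H.μ₁) n z := by
  refine ⟨∑ j : Fin (n + 1), (-1 : ℤ) ^ (j : ℕ) • H.homotopyTerm j z, ?_⟩
  -- `K i` is the common value of the `i`-th faces of the homotopy terms `i` and `i - 1`; its two
  -- extreme values are the two chain maps.
  let K : Fin (n + 2) → Chains k B N n :=
    Fin.lastCases (traceMap (fun _ _ : Unit => H.f₁) (fun _ _ => H.μ₁) n z)
      fun j => face k j.castSucc (H.homotopyTerm j z)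
  have hK (j : Fin (n + 1)) : face k j.castSucc (H.homotopyTerm j z) = K j.castSucc := by
    simp only [K, Fin.lastCases_castSucc]
  have hK' (j : Fin (n + 1)) : face k j.succ (H.homotopyTerm j z) = K j.succ := by
    refine Fin.lastCases ?_ (fun j => ?_) j
    · simp only [K, Fin.succ_last, Fin.lastCases_last]
      refine LinearMap.congr_fun (f := face k (Fin.last (n + 1)) ∘ₗ H.homotopyTerm (Fin.last n))
        (chains_hom_ext fun x => ?_) z
      rw [LinearMap.comp_apply, homotopyTerm_pureTensor, face_pureTensor,
        faceTuple_last_homotopyTuple, traceMap_unit_pureTensor]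
    · rw [Fin.succ_castSucc, ← hK]
      refine LinearMap.congr_fun (f := face k j.succ.castSucc ∘ₗ H.homotopyTerm j.castSucc)
        (g := face k j.succ.castSucc ∘ₗ H.homotopyTerm j.succ) (chains_hom_ext fun x => ?_) z
      simp only [LinearMap.comp_apply, homotopyTerm_pureTensor, face_pureTensor,
        faceTuple_homotopyTuple_succ]
  have h0 : K 0 = traceMap (fun _ _ : Unit => H.f₀) (fun _ _ => H.μ₀) n z := by
    refine (hK 0).symm.trans (LinearMap.congr_fun (f := face k 0 ∘ₗ H.homotopyTerm 0)
        (chains_hom_ext fun x => ?_) z)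
    rw [LinearMap.comp_apply, homotopyTerm_pureTensor, face_pureTensor,
      faceTuple_zero_homotopyTuple, traceMap_unit_pureTensor]
  have hl : K (Fin.last _) = traceMap (fun _ _ : Unit => H.f₁) (fun _ _ => H.μ₁) n z := by
    simp only [K, Fin.lastCases_last]
  have hb : hochschildBoundary k B N n (∑ j : Fin (n + 1), (-1 : ℤ) ^ (j : ℕ) • H.homotopyTerm j z) =
      ∑ j : Fin (n + 1), ∑ i : Fin (n + 2), ((-1 : ℤ) ^ (j : ℕ) * (-1) ^ (i : ℕ)) •
        face k i (H.homotopyTerm j z) := by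
    simp only [map_sum, map_zsmul, hochschildBoundary, LinearMap.sum_apply, LinearMap.smul_apply,
      Finset.smul_sum, smul_smul]
  rw [hb]
  cases n with
  | zero =>
    rw [alternating_homotopy_sum _ (fun j => j.elim0) K hK hK' (fun i j => j.elim0)
      (fun i j => j.elim0), h0, hl]
    simp
  | succ n =>
    rw [alternating_homotopy_sum _ (fun j i => H.homotopyTerm j (face k i z)) K hK hK' ?_ ?_, h0, hl]
    -- For each `j` the leftover terms add up to the `j`-th homotopy term of the boundary of `z`,
    -- which vanishes.
    · rw [Finset.sum_comm, sub_eq_self]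
      have hz' : ∑ i : Fin (n + 2), (-1 : ℤ) ^ (i : ℕ) • face k i z = 0 := by
        simpa [IsHochschildCycle, hochschildBoundary, LinearMap.sum_apply] using hz
      refine Finset.sum_eq_zero fun j _ => ?_
      have := congrArg (fun y => (-1 : ℤ) ^ (j : ℕ) • H.homotopyTerm j y) hz'
      simpa only [map_sum, map_zsmul, Finset.smul_sum, smul_smul, map_zero, smul_zero] using this
    · intro i j h
      refine LinearMap.congr_fun (f := face k i.castSucc ∘ₗ H.homotopyTerm j.succ)
        (g := H.homotopyTerm j ∘ₗ face k i) (chains_hom_ext fun x => ?_) z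
      simp only [LinearMap.comp_apply, homotopyTerm_pureTensor, face_pureTensor,
        faceTuple_castSucc_homotopyTuple_succ H i j h]
    · intro i j h
      refine LinearMap.congr_fun (f := face k i.succ ∘ₗ H.homotopyTerm j.castSucc)
        (g := H.homotopyTerm j ∘ₗ face k i) (chains_hom_ext fun x => ?_) z
      simp only [LinearMap.comp_apply, homotopyTerm_pureTensor, face_pureTensor,
        faceTuple_succ_homotopyTuple_castSucc H i j h]

end Homotopy

/-! ### Matrices over a bimodule -/

section Matrices

variable {k : Type v} [CommRing k] {A : Type u} [Ring A] [Algebra k A]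

/-- Left multiplication of matrices with entries in a module. -/
abbrev matrixLeftModule (ι : Type) [Fintype ι] [DecidableEq ι] (A M : Type u) [Ring A]
    [AddCommGroup M] [Module A M] : Module (Matrix ι ι A) (ι → ι → M) where
  smul X G i j := ∑ l, X i l • G l j
  one_smul G := funext fun i => funext fun j => by
    change ∑ l, (1 : Matrix ι ι A) i l • G l j = G i j
    simp [Matrix.one_apply]
  mul_smul X Y G := funext fun i => funext fun j => by
    change ∑ l, (X * Y) i l • G l j = ∑ l, X i l • ∑ l', Y l l' • G l' j
    simp only [Matrix.mul_apply, Finset.sum_smul, Finset.smul_sum, mul_smul]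
    exact Finset.sum_comm
  smul_zero X := funext fun i => funext fun j => by
    change ∑ l, X i l • (0 : M) = 0
    simp
  smul_add X G G' := funext fun i => funext fun j => by
    change ∑ l, X i l • (G l j + G' l j) = ∑ l, X i l • G l j + ∑ l, X i l • G' l j
    simp [Finset.sum_add_distrib]
  add_smul X Y G := funext fun i => funext fun j => by
    change ∑ l, (X i l + Y i l) • G l j = ∑ l, X i l • G l j + ∑ l, Y i l • G l j
    simp [Finset.sum_add_distrib, add_smul]
  zero_smul G := funext fun i => funext fun j => by
    change ∑ l, (0 : A) • G l j = 0
    simp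

/-- Right multiplication of matrices with entries in a module. -/
abbrev matrixRightModule (ι : Type) [Fintype ι] [DecidableEq ι] (A M : Type u) [Ring A]
    [AddCommGroup M] [Module Aᵐᵒᵖ M] : Module (Matrix ι ι A)ᵐᵒᵖ (ι → ι → M) where
  smul X G i j := ∑ l, op (X.unop l j) • G i l
  one_smul G := funext fun i => funext fun j => by
    change ∑ l, op ((1 : Matrix ι ι A) l j) • G i l = G i j
    rw [Finset.sum_eq_single j (fun l _ h => by simp [h]) (by simp)]
    simp
  mul_smul X Y G := funext fun i => funext fun j => by
    change ∑ l, op ((Y.unop * X.unop) l j) • G i l =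
      ∑ l, op (X.unop l j) • ∑ l', op (Y.unop l' l) • G i l'
    simp only [Matrix.mul_apply, Finset.smul_sum, Finset.op_sum, op_mul, Finset.sum_smul, mul_smul]
    exact Finset.sum_comm
  smul_zero X := funext fun i => funext fun j => by
    change ∑ l, op (X.unop l j) • (0 : M) = 0
    simp
  smul_add X G G' := funext fun i => funext fun j => by
    change ∑ l, op (X.unop l j) • (G i l + G' i l) =
      ∑ l, op (X.unop l j) • G i l + ∑ l, op (X.unop l j) • G' i l
    simp [Finset.sum_add_distrib]
  add_smul X Y G := funext fun i => funext fun j => by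
    change ∑ l, op (X.unop l j + Y.unop l j) • G i l =
      ∑ l, op (X.unop l j) • G i l + ∑ l, op (Y.unop l j) • G i l
    simp [Finset.sum_add_distrib, add_smul]
  zero_smul G := funext fun i => funext fun j => by
    change ∑ l, op (0 : A) • G i l = 0
    simp

/-- The bimodule of square matrices with entries in `M` over the matrix algebra. -/
def Bimodule.matrix (ι : Type) [Fintype ι] [DecidableEq ι] (M : Bimodule k A A) :
    Bimodule k (Matrix ι ι A) (Matrix ι ι A) where
  carrier := ι → ι → M
  left := matrixLeftModule ι A M
  right := matrixRightModule ι A M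
  leftTower :=
    letI := matrixLeftModule ι A M
    ⟨fun c X G => funext fun i => funext fun j => by
      change ∑ l, (c • X i l) • G l j = c • ∑ l, X i l • G l j
      simp [Finset.smul_sum]⟩
  rightTower :=
    letI := matrixRightModule ι A M
    ⟨fun c X G => funext fun i => funext fun j => by
      change ∑ l, op (c • X.unop l j) • G i l = c • ∑ l, op (X.unop l j) • G i l
      simp [Finset.smul_sum]⟩
  comm :=
    letI := matrixLeftModule ι A M
    letI := matrixRightModule ι A M
    ⟨fun X Y G => funext fun i => funext fun j => by
      change ∑ l, X i l • ∑ l', op (Y.unop l' j) • G l l' =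
        ∑ l', op (Y.unop l' j) • ∑ l, X i l • G l l'
      simp only [Finset.smul_sum]
      rw [Finset.sum_comm]
      simp only [smul_comm (X _ _) (op _)]⟩

theorem Bimodule.matrix_smul_apply {ι : Type} [Fintype ι] [DecidableEq ι] {M : Bimodule k A A}
    (X : Matrix ι ι A) (G : M.matrix ι) (i j : ι) :
    (X • G : ι → ι → M) i j = ∑ l, X i l • (G : ι → ι → M) l j := rfl

theorem Bimodule.matrix_op_smul_apply {ι : Type} [Fintype ι] [DecidableEq ι] {M : Bimodule k A A}
    (X : Matrix ι ι A) (G : M.matrix ι) (i j : ι) :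
    (op X • G : ι → ι → M) i j = ∑ l, op (X l j) • (G : ι → ι → M) i l := rfl

/-! ### Conjugations as one diagonal block of a multiplicative map on 2 × 2 matrices -/

variable {ι : Type} [Fintype ι]

/-- The conjugation `x ↦ (bᵢ x aⱼ)` attached to a decomposition `1 = ∑ aᵢ bᵢ`. -/
def conj (k : Type v) [CommRing k] [Algebra k A] (a b : ι → A) (h : ∑ i, a i * b i = 1) :
    MatAlgHom k ι A A where
  entry i j := LinearMap.mulLeft k (b i) ∘ₗ LinearMap.mulRight k (a j)
  entry_mul i j x y := by
    have : b i * (x * y * a j) = b i * (x * ((∑ l, a l * b l) * (y * a j))) := by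
      rw [h, one_mul, mul_assoc]
    simp only [LinearMap.comp_apply, LinearMap.mulLeft_apply, LinearMap.mulRight_apply]
    rw [this, Finset.sum_mul, Finset.mul_sum, Finset.mul_sum]
    simp only [mul_assoc]

theorem conj_entry_apply (a b : ι → A) (h : ∑ i, a i * b i = 1) (i j : ι) (x : A) :
    (conj k a b h).entry i j x = b i * (x * a j) := rfl

/-- The conjugation `m ↦ (bᵢ m aⱼ)` on a bimodule. -/
def conjHom (a b : ι → A) (h : ∑ i, a i * b i = 1) (M : Bimodule k A A) :
    MatHom (conj k a b h) M M where
  entry i j := Algebra.lsmul k k M (b i) ∘ₗ Algebra.lsmul k k M (op (a j))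
  entry_smul i j x m := by
    have : b i • op (a j) • x • m = b i • x • (∑ l, a l * b l) • op (a j) • m := by
      rw [h, one_smul, smul_comm x]
    simp only [LinearMap.comp_apply, Algebra.lsmul_coe, conj_entry_apply]
    rw [this, Finset.sum_smul, Finset.smul_sum, Finset.smul_sum]
    simp only [mul_smul]
  entry_op_smul i j x m := by
    have : b i • op (a j) • op x • m = op (a j) • op x • op (∑ l, a l * b l) • b i • m := by
      rw [h, op_one, one_smul, smul_comm (b i), smul_comm (b i)]
    simp only [LinearMap.comp_apply, Algebra.lsmul_coe, conj_entry_apply]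
    rw [this, Finset.op_sum, Finset.sum_smul, Finset.smul_sum, Finset.smul_sum]
    simp only [op_mul, mul_smul, smul_comm (b i)]

theorem conjHom_entry_apply (a b : ι → A) (h : ∑ i, a i * b i = 1) (M : Bimodule k A A) (i j : ι)
    (m : M) : (conjHom a b h M).entry i j m = b i • op (a j) • m := rfl

/-- The coefficients `1` and `aᵢ` of the two blocks of `spread`. -/
def extendByOne (a : ι → A) (i : Option ι) : A := i.elim 1 a

/-- The morphism from `2 × 2` matrices which is the identity on the first diagonal block and a
conjugation on the second. -/
def spread (k : Type v) [CommRing k] [Algebra k A] (a b : ι → A) (h : ∑ i, a i * b i = 1) :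
    MatAlgHom k (Option ι) (Matrix Bool Bool A) A where
  entry i j := LinearMap.mulLeft k (extendByOne b i) ∘ₗ LinearMap.mulRight k (extendByOne a j) ∘ₗ
    Matrix.entryLinearMap k A i.isSome j.isSome
  entry_mul i j X Y := by
    -- The map is $X\mapsto\tilde bX\tilde a$, with $\tilde a$ and $\tilde b$ block diagonal with
    -- blocks $1,(a_l)$ and $1,(b_l)$. Multiplicativity is $\tilde a\tilde b=1$; the first block
    -- (`none`, `false`) is trivial and the second (`some`, `true`) is this identity.
    have (c d : A) : ∑ l, (c * a l) * (b l * d) = c * d := by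
      have : c * d = c * ((∑ l, a l * b l) * d) := by rw [h, one_mul]
      rw [this, Finset.sum_mul, Finset.mul_sum]
      simp only [mul_assoc]
    simp only [LinearMap.comp_apply, LinearMap.mulLeft_apply, LinearMap.mulRight_apply,
      Matrix.entryLinearMap_apply, Fintype.sum_option, Matrix.mul_apply, Fintype.sum_bool,
      extendByOne, Option.elim, Option.isSome]
    simp only [mul_one, one_mul, ← mul_assoc _ _ (a _), this]
    simp only [mul_add, add_mul, mul_assoc]
    exact add_comm _ _

theorem spread_entry_apply (a b : ι → A) (h : ∑ i, a i * b i = 1) (i j : Option ι)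
    (X : Matrix Bool Bool A) : (spread k a b h).entry i j X =
      extendByOne b i * (X i.isSome j.isSome * extendByOne a j) := rfl

/-- The relation $\tilde a\tilde b=1$ for left actions: a sum over the refined indices collapses to
a sum over the two blocks. The next lemma is the version for right actions. -/
theorem spread_coeff_smul (a b : ι → A) (h : ∑ i, a i * b i = 1) {M : Type u} [AddCommGroup M]
    [Module A M] (x : Bool → A) (m : Bool → M) :
    ∑ l : Option ι, (x l.isSome * extendByOne a l) • extendByOne b l • m l.isSome =
      ∑ l, x l • m l := by
  have : ∑ l, (x true * a l) • b l • m true = x true • m true := by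
    have : x true • m true = x true • (∑ l, a l * b l) • m true := by rw [h, one_smul]
    rw [this, Finset.sum_smul, Finset.smul_sum]
    simp only [mul_smul]
  simp [Fintype.sum_option, extendByOne, this, add_comm]

theorem spread_coeff_op_smul (a b : ι → A) (h : ∑ i, a i * b i = 1) {M : Type u}
    [AddCommGroup M] [Module Aᵐᵒᵖ M] (x : Bool → A) (m : Bool → M) :
    ∑ l : Option ι, op (extendByOne b l * x l.isSome) • op (extendByOne a l) • m l.isSome =
      ∑ l, op (x l) • m l := by
  have : ∑ l, op (b l * x true) • op (a l) • m true = op (x true) • m true := by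
    have : op (x true) • m true = op (x true) • op (∑ l, a l * b l) • m true := by
      rw [h, op_one, one_smul]
    rw [this, Finset.op_sum, Finset.sum_smul, Finset.smul_sum]
    simp only [op_mul, mul_smul]
  simp only [Fintype.sum_option, Fintype.sum_bool, extendByOne, Option.elim, Option.isSome, this,
    one_mul, op_one, one_smul]
  exact add_comm _ _

/-- The `(i, j)` entry of a matrix over a bimodule. -/
def Bimodule.matrixEntry (M : Bimodule k A A) (i j : Bool) : M.matrix Bool →ₗ[k] M :=
  (LinearMap.proj j ∘ₗ LinearMap.proj i : (Bool → Bool → M) →ₗ[k] M)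

/-- The map of bimodules over `spread`. -/
def spreadHom (a b : ι → A) (h : ∑ i, a i * b i = 1) (M : Bimodule k A A) :
    MatHom (spread k a b h) (M.matrix Bool) M where
  entry i j := Algebra.lsmul k k M (extendByOne b i) ∘ₗ Algebra.lsmul k k M (op (extendByOne a j)) ∘ₗ
    M.matrixEntry i.isSome j.isSome
  entry_smul i j X G := by
    have := spread_coeff_smul a b h (fun l => X i.isSome l)
      (fun l => op (extendByOne a j) • (G : Bool → Bool → M) l j.isSome)
    change extendByOne b i • op (extendByOne a j) •
      ∑ l, X i.isSome l • (G : Bool → Bool → M) l j.isSome = ∑ l : Option ι,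
        (extendByOne b i * (X i.isSome l.isSome * extendByOne a l)) • extendByOne b l •
          op (extendByOne a j) • (G : Bool → Bool → M) l.isSome j.isSome
    simp only [mul_smul (extendByOne b i), ← Finset.smul_sum, this]
    simp only [Finset.smul_sum, smul_comm (X _ _) (op (extendByOne a j))]
  entry_op_smul i j X G := by
    have := spread_coeff_op_smul a b h (fun l => X l j.isSome)
      (fun l => extendByOne b i • (G : Bool → Bool → M) i.isSome l)
    change extendByOne b i • op (extendByOne a j) •
      ∑ l, op (X l j.isSome) • (G : Bool → Bool → M) i.isSome l = ∑ l : Option ι,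
        op (extendByOne b l * (X l.isSome j.isSome * extendByOne a j)) • extendByOne b i •
          op (extendByOne a l) • (G : Bool → Bool → M) i.isSome l.isSome
    simp only [← mul_assoc, op_mul _ (extendByOne a j), mul_smul (op (extendByOne a j)),
      ← Finset.smul_sum, smul_comm (extendByOne b i) (op _), this]
    simp only [Finset.smul_sum, smul_comm (extendByOne b i) (op _)]

theorem spreadHom_entry_apply (a b : ι → A) (h : ∑ i, a i * b i = 1) (M : Bimodule k A A)
    (i j : Option ι) (G : M.matrix Bool) : (spreadHom a b h M).entry i j G =
      extendByOne b i • op (extendByOne a j) • (G : Bool → Bool → M) i.isSome j.isSome := rfl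

/-- The inclusion of a bimodule into matrices as a diagonal entry. -/
def Bimodule.corner (M : Bimodule k A A) (c : Bool) : M →ₗ[k] M.matrix Bool :=
  (LinearMap.single k (fun _ : Bool => Bool → M) c ∘ₗ LinearMap.single k (fun _ : Bool => M) c :
    M →ₗ[k] Bool → Bool → M)

theorem Bimodule.corner_apply (M : Bimodule k A A) (c : Bool) (m : M) (i j : Bool) :
    (M.corner c m : Bool → Bool → M) i j = if i = c ∧ j = c then m else 0 := by
  change (Pi.single c (Pi.single c m : Bool → M) : Bool → Bool → M) i j = _
  revert c i j
  simp [Bool.forall_bool]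

/-- The inclusions of an algebra and of a bimodule as the two diagonal entries of `2 × 2`
matrices are conjugate. -/
def cornerIntertwiner (M : Bimodule k A A) :
    Intertwiner k A (Matrix Bool Bool A) M (M.matrix Bool) where
  f₀ := Matrix.singleLinearMap k false false
  f₁ := Matrix.singleLinearMap k true true
  μ₀ := M.corner false
  μ₁ := M.corner true
  -- The matrix units exchange the corners: $uv$ and $vu$ are the two diagonal idempotents, and
  -- $v(xe)u$ moves $x$ from the first corner to the second.
  u := Matrix.single false true 1
  v := Matrix.single true false 1
  f₀_mul x y := by simp
  f₁_mul x y := by simp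
  μ₀_smul x m := funext fun i => funext fun j => by
    revert i j
    simp only [Bimodule.matrix_smul_apply, Bimodule.corner_apply]
    simp [Bool.forall_bool, Matrix.single_apply]
  μ₀_op_smul x m := funext fun i => funext fun j => by
    revert i j
    simp only [Bimodule.matrix_op_smul_apply, Bimodule.corner_apply]
    simp [Bool.forall_bool, Matrix.single_apply]
  f₁_mul_v x := by simp
  op_v_smul m := funext fun i => funext fun j => by
    revert i j
    simp only [Bimodule.matrix_op_smul_apply, Bimodule.corner_apply]
    simp [Bool.forall_bool, Matrix.single_apply]
  v_smul m := funext fun i => funext fun j => by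
    revert i j
    simp only [Bimodule.matrix_smul_apply, Bimodule.matrix_op_smul_apply, Bimodule.corner_apply]
    simp [Bool.forall_bool, Matrix.single_apply]

theorem traceMap_unit_id {M : Type u} [AddCommGroup M] [Module k M] (n : ℕ) :
    traceMap (fun _ _ : Unit => (LinearMap.id : A →ₗ[k] A))
      (fun _ _ => (LinearMap.id : M →ₗ[k] M)) n = LinearMap.id :=
  chains_hom_ext fun x => by
    rw [traceMap_unit_pureTensor]
    rfl

/-- In the composite only the constant cycle at `none` survives, and there `spread` has coefficients
1. The equality holds already on chains. -/
theorem traceMap_spread_comp_corner_false (a b : ι → A) (h : ∑ i, a i * b i = 1)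
    (M : Bimodule k A A) (n : ℕ) :
    traceMap (spread k a b h).entry (spreadHom a b h M).entry n ∘ₗ
      traceMap (fun _ _ : Unit => Matrix.singleLinearMap k false false)
        (fun _ _ => M.corner false) n = LinearMap.id := by
  rw [traceMap_comp, ← traceMap_unit_id n]
  refine traceMap_eq_of_injective (fun _ => ((), none)) (fun _ _ _ => rfl) ?_ ?_ ?_ ?_ n
  · rintro - -
    ext x
    simp [spread_entry_apply, extendByOne]
  · rintro - -
    ext x
    simp [spreadHom_entry_apply, Bimodule.corner_apply, extendByOne]
  · rintro ⟨_, _ | i⟩ ⟨_, j⟩ hi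
    · exact absurd ⟨(), rfl⟩ hi
    · ext x
      simp [spread_entry_apply]
  · rintro ⟨_, _ | i⟩ ⟨_, j⟩ hi
    · exact absurd ⟨(), rfl⟩ hi
    · ext x
      simp [spreadHom_entry_apply, Bimodule.corner_apply]

/-- Only cycles in the second block survive, and they are exactly those of the conjugation. -/
theorem traceMap_spread_comp_corner_true (a b : ι → A) (h : ∑ i, a i * b i = 1)
    (M : Bimodule k A A) (n : ℕ) :
    traceMap (spread k a b h).entry (spreadHom a b h M).entry n ∘ₗ
      traceMap (fun _ _ : Unit => Matrix.singleLinearMap k true true)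
        (fun _ _ => M.corner true) n = traceMap (conj k a b h).entry (conjHom a b h M).entry n := by
  rw [traceMap_comp]
  refine traceMap_eq_of_injective (fun i => ((), some i)) (fun _ _ e => by simpa using e)
    ?_ ?_ ?_ ?_ n
  · intro i j
    ext x
    simp [spread_entry_apply, conj_entry_apply, extendByOne]
  · intro i j
    ext x
    simp [spreadHom_entry_apply, conjHom_entry_apply, Bimodule.corner_apply, extendByOne]
  · rintro ⟨_, _ | i⟩ ⟨_, j⟩ hi
    · ext x
      simp [spread_entry_apply]
    · exact absurd ⟨i, rfl⟩ hi
  · rintro ⟨_, _ | i⟩ ⟨_, j⟩ hi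
    · ext x
      simp [spreadHom_entry_apply, Bimodule.corner_apply]
    · exact absurd ⟨i, rfl⟩ hi

/-- Conjugations act trivially on Hochschild homology. -/
theorem exists_boundary_conj (a b : ι → A) (h : ∑ i, a i * b i = 1) (M : Bimodule k A A) {n : ℕ}
    (z : Chains k A M n) (hz : IsHochschildCycle k z) : ∃ w, hochschildBoundary k A M n w =
      z - traceMap (conj k a b h).entry (conjHom a b h M).entry n z := by
  obtain ⟨w, hw⟩ := (cornerIntertwiner M).exists_boundary z hz
  -- The chain `w` bounds the difference of the two corner images over the matrix algebra; the trace
  -- of `spread` carries that difference to identity minus conjugation.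
  refine ⟨traceMap (spread k a b h).entry (spreadHom a b h M).entry (n + 1) w, ?_⟩
  have h1 := LinearMap.congr_fun (hochschildBoundary_comp_traceMap (spreadHom a b h M) n) w
  have h2 := LinearMap.congr_fun (traceMap_spread_comp_corner_false a b h M n) z
  have h3 := LinearMap.congr_fun (traceMap_spread_comp_corner_true a b h M n) z
  simp only [LinearMap.comp_apply, LinearMap.id_apply] at h1 h2 h3
  rw [h1, hw, map_sub]
  exact congrArg₂ (· - ·) h2 h3

end Matrices

/-! ### Conjugations act trivially on cyclic homology -/

section CyclicConj

variable {k : Type v} [CommRing k] {A : Type u} [Ring A] [Algebra k A]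

/-- The contraction `r₀ ⊗ ⋯ ⊗ rₙ ↦ 1 ⊗ r₀ ⊗ ⋯ ⊗ rₙ` of the bar complex. -/
def barContraction (k : Type v) [CommRing k] (A : Type u) [Ring A] [Algebra k A] (n : ℕ) :
    Chains k A A n →ₗ[k] Chains k A A (n + 1) :=
  -- Appending 1 and rotating without sign puts 1 in front.
  rot k A (n + 1) ∘ₗ insertChain (Fin.last n) 1

theorem barContraction_pureTensor {n : ℕ} (x : A × (Fin n → A)) :
    barContraction k A n (pureTensor k x) = pureTensor k (1, Fin.cons x.1 x.2) := by
  rw [barContraction, LinearMap.comp_apply, insertChain_pureTensor, rot_pureTensor]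
  simp [rotTuple]

theorem face_zero_comp_barContraction (n : ℕ) :
    face k 0 ∘ₗ barContraction k A n = LinearMap.id :=
  chains_hom_ext fun x => by
    simp [barContraction_pureTensor, face_pureTensor, faceTuple]

/-- The leading 1 shifts all faces by one. The face of the shorter chain is not the last one, so no
cyclic wrap-around disturbs the 1; this is why the contraction suits $b'$. -/
theorem face_succ_comp_barContraction {n : ℕ} (i : Fin (n + 1)) :
    face k i.succ.castSucc ∘ₗ barContraction k A (n + 1) =
      barContraction k A n ∘ₗ face k i.castSucc :=
  chains_hom_ext fun x => by
    simp only [LinearMap.comp_apply, barContraction_pureTensor, face_pureTensor]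
    obtain ⟨i, hi⟩ := i
    refine congrArg _ (Prod.ext ?_ (funext fun a => ?_))
    · have : i ≠ n + 1 := by omega
      simp [faceTuple, this]
    · refine Fin.cases ?_ (fun a => ?_) a
      · rcases Nat.eq_zero_or_pos i with rfl | h0
        · simp [faceTuple]
        · have h1 : i ≠ 0 := by omega
          have h2 : i ≠ n + 1 := by omega
          simp [faceTuple, h0, h1, h2]
      · simp only [faceTuple, Fin.val_succ, Fin.cons_succ, Fin.castSucc_mk,
          Fin.succ_mk, ← Fin.succ_castSucc, Nat.add_lt_add_iff_right, Nat.add_right_cancel_iff]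

theorem barBoundary_comp_barContraction_zero :
    barBoundary k A A 0 ∘ₗ barContraction k A 0 = LinearMap.id := by
  rw [barBoundary, Fin.sum_univ_one]
  simpa using face_zero_comp_barContraction (k := k) (A := A) 0

/-- This is $b's+sb'=1$: face 0 gives the identity, and the shift of the other faces changes their
sign. -/
theorem barBoundary_comp_barContraction (n : ℕ) :
    barBoundary k A A (n + 1) ∘ₗ barContraction k A (n + 1) =
      LinearMap.id - barContraction k A n ∘ₗ barBoundary k A A n := by
  rw [barBoundary, barBoundary, Fin.sum_univ_succ, LinearMap.add_comp, sum_comp, comp_sum,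
    sub_eq_add_neg, ← Finset.sum_neg_distrib]
  congr 1
  · simpa using face_zero_comp_barContraction (k := k) (A := A) (n + 1)
  · refine Finset.sum_congr rfl fun i _ => ?_
    rw [LinearMap.smul_comp, face_succ_comp_barContraction, LinearMap.comp_smul, Fin.val_succ,
      pow_succ, mul_neg_one, neg_smul]

/-- A chain is a cycle of the column `p` of the cyclic bicomplex. -/
def IsVerticalCycle (k : Type v) [CommRing k] {A : Type u} [Ring A] [Algebra k A] (p : ℕ) :
    {n : ℕ} → Chains k A A n → Prop
  | 0, _ => True
  | n + 1, z => vertical k A p n z = 0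

/-- A cycle of the total complex of the cyclic bicomplex. -/
def IsCyclicCycle (k : Type v) [CommRing k] {A : Type u} [Ring A] [Algebra k A] :
    {n : ℕ} → CyclicTotal k A n → Prop
  | 0, _ => True
  | n + 1, z => cyclicBoundary k A n z = 0

/-! ### The column filtration -/

variable {ι : Type} [Fintype ι]

/-- `G` acts trivially on Hochschild homology. -/
def ActsTrivially (G : MatAlgHom k ι A A) : Prop :=
  ∀ (n : ℕ) (z : Chains k A A n), IsHochschildCycle k z →
    ∃ w, hochschildBoundary k A A n w = z - traceMap G.entry G.entry n z

/-- In even columns this is the hypothesis on Hochschild homology. In odd columns $z-Gz$ is a cycle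
for $b'$, because traces commute with $b'$, and the contraction bounds it. -/
theorem ActsTrivially.exists_vertical {G : MatAlgHom k ι A A} (hG : ActsTrivially G) (p : ℕ)
    {n : ℕ} (z : Chains k A A n) (hz : IsVerticalCycle k p z) :
    ∃ w, vertical k A p n w = z - traceMap G.entry G.entry n z := by
  by_cases hp : Even p
  · have hz' : IsHochschildCycle k z := by
      cases n with
      | zero => trivial
      | succ n =>
        change hochschildBoundary k A A n z = 0
        simpa [IsVerticalCycle, vertical, hp] using hz
    simpa [vertical, hp] using hG n z hz'
  -- The sign cancels the one in the vertical differential $-b'$ of odd columns.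
  · refine ⟨-barContraction k A n (z - traceMap G.entry G.entry n z), ?_⟩
    simp only [vertical, hp, if_false, LinearMap.neg_apply, map_neg, neg_neg]
    cases n with
    | zero => exact LinearMap.congr_fun barBoundary_comp_barContraction_zero _
    | succ n =>
      refine (LinearMap.congr_fun (barBoundary_comp_barContraction n) _).trans ?_
      have hz' : barBoundary k A A n z = 0 := by
        simpa [IsVerticalCycle, vertical, hp] using hz
      have h := LinearMap.congr_fun (barBoundary_comp_traceMap G.self n) z
      simp only [LinearMap.comp_apply, hz', map_zero] at h
      simp only [LinearMap.sub_apply, LinearMap.comp_apply, map_sub, hz', LinearMap.id_apply]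
      rw [show barBoundary k A A n (traceMap G.entry G.entry (n + 1) z) = 0 from h]
      simp

theorem isCyclicCycle_cyclicBoundary {n : ℕ} (w : CyclicTotal k A (n + 1)) :
    IsCyclicCycle k (cyclicBoundary k A n w) := by
  cases n with
  | zero => trivial
  | succ n => exact LinearMap.congr_fun (cyclicBoundary_comp k A n) w

theorem IsCyclicCycle.sub {n : ℕ} {z z' : CyclicTotal k A n} (h : IsCyclicCycle k z)
    (h' : IsCyclicCycle k z') : IsCyclicCycle k (z - z') := by
  cases n with
  | zero => trivial
  | succ n => exact (map_sub (cyclicBoundary k A n) z z').trans (by rw [h, h', sub_zero])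

theorem IsCyclicCycle.trace {B : Type u} [Ring B] [Algebra k B] (G : MatAlgHom k ι A B) {n : ℕ}
    {z : CyclicTotal k A n} (h : IsCyclicCycle k z) :
    IsCyclicCycle k (cyclicTotalTrace G.entry n z) := by
  cases n with
  | zero => trivial
  | succ n =>
    refine (LinearMap.congr_fun (cyclicBoundary_comp_cyclicTotalTrace G n) z).trans ?_
    rw [LinearMap.comp_apply, h, map_zero]

theorem cyclicTotalTrace_apply {B : Type u} [Ring B] [Algebra k B] (f : ι → ι → A →ₗ[k] B) (n : ℕ)
    (z : CyclicTotal k A n) (q : Fin (n + 1)) :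
    cyclicTotalTrace f n z q = traceMap f f q (z q) := rfl

theorem cyclicBoundary_apply {n : ℕ} (w : CyclicTotal k A (n + 1)) (q : Fin (n + 1)) :
    cyclicBoundary k A n w q =
      vertical k A (n - q) q (w q.succ) + horizontal k A (n + 1 - q) q (w q.castSucc) := rfl

/-- If `G` acts trivially on Hochschild homology, then `1 - G` lowers the column filtration of
cyclic cycles up to boundaries. -/
theorem ActsTrivially.exists_filtration_step {G : MatAlgHom k ι A A} (hG : ActsTrivially G) {n : ℕ}
    {z : CyclicTotal k A n} (hz : IsCyclicCycle k z) (c : ℕ)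
    (hc : ∀ q : Fin (n + 1), (q : ℕ) < c → z q = 0) :
    ∃ (w : CyclicTotal k A (n + 1)) (z' : CyclicTotal k A n),
      z - cyclicTotalTrace G.entry n z = cyclicBoundary k A n w + z' ∧ IsCyclicCycle k z' ∧
        ∀ q : Fin (n + 1), (q : ℕ) < c + 1 → z' q = 0 := by
  by_cases hn : c < n + 1
  -- Row `c` lies in the highest column that can be nonzero. The component of the total boundary in
  -- row `c - 1` of that column gets no horizontal contribution, so the vertical one vanishes.
  · have hv : IsVerticalCycle k (n - c) (z ⟨c, hn⟩) := by
      cases c with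
      | zero => trivial
      | succ c =>
        cases n with
        | zero => omega
        | succ n =>
          have h := congrFun (show cyclicBoundary k A n z = 0 from hz) ⟨c, by omega⟩
          rw [cyclicBoundary_apply, hc (⟨c, by omega⟩ : Fin (n + 1)).castSucc (Nat.lt_succ_self c),
            map_zero, add_zero] at h
          have e : n + 1 - (c + 1) = n - c := by omega
          rw [e]
          exact h
    obtain ⟨w, hw⟩ := hG.exists_vertical _ _ hv
    -- In total degree `n + 1`, row `c + 1` is the same column `n - c`. The horizontal part of the
    -- boundary of `W` lands in row `c + 1`, so rows up to `c` see only the vertical part.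
    let W : CyclicTotal k A (n + 1) := Pi.single (⟨c, hn⟩ : Fin (n + 1)).succ w
    refine ⟨W, z - cyclicTotalTrace G.entry n z - cyclicBoundary k A n W, by abel,
      (hz.sub (hz.trace G)).sub (isCyclicCycle_cyclicBoundary W), fun q hq => ?_⟩
    rcases (Nat.lt_succ_iff.1 hq).lt_or_eq with h | h
    · have h1 : q.succ ≠ (⟨c, hn⟩ : Fin (n + 1)).succ := by
        rw [Ne, Fin.succ_inj, Fin.ext_iff]
        exact h.ne
      have h2 : q.castSucc ≠ (⟨c, hn⟩ : Fin (n + 1)).succ := by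
        rw [Ne, Fin.ext_iff]
        simp
        omega
      rw [Pi.sub_apply, Pi.sub_apply, cyclicTotalTrace_apply, cyclicBoundary_apply, hc q h]
      simp only [W]
      rw [Pi.single_eq_of_ne h1, Pi.single_eq_of_ne h2]
      simp
    · obtain rfl : q = ⟨c, hn⟩ := Fin.ext h
      have h2 : (⟨c, hn⟩ : Fin (n + 1)).castSucc ≠ (⟨c, hn⟩ : Fin (n + 1)).succ := by
        rw [Ne, Fin.ext_iff]
        simp
      rw [Pi.sub_apply, Pi.sub_apply, cyclicTotalTrace_apply, cyclicBoundary_apply]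
      simp only [W]
      rw [Pi.single_eq_same, Pi.single_eq_of_ne h2, hw]
      simp
  · have : z = 0 := funext fun q => hc q (by omega)
    subst this
    exact ⟨0, 0, by simp, by cases n <;> simp [IsCyclicCycle], by simp⟩

theorem ActsTrivially.exists_cyclicBoundary {G : MatAlgHom k ι A A} (hG : ActsTrivially G) {n : ℕ}
    {z : CyclicTotal k A n} (hz : IsCyclicCycle k z) (hGz : cyclicTotalTrace G.entry n z = 0) :
    ∃ w, cyclicBoundary k A n w = z := by
  have key (c : ℕ) : ∃ (w : CyclicTotal k A (n + 1)) (z' : CyclicTotal k A n),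
      z = cyclicBoundary k A n w + z' ∧ IsCyclicCycle k z' ∧
        ∀ q : Fin (n + 1), (q : ℕ) < c → z' q = 0 := by
    induction c with
    | zero => exact ⟨0, z, by simp, hz, by simp⟩
    | succ c ih =>
      obtain ⟨w, z', e, h1, h2⟩ := ih
      obtain ⟨w', z'', e', h1', h2'⟩ := hG.exists_filtration_step h1 c h2
      refine ⟨w - cyclicTotalTrace G.entry (n + 1) w + w', z'', ?_, h1', h2'⟩
      have h3 := LinearMap.congr_fun (cyclicBoundary_comp_cyclicTotalTrace G n) w
      -- Since $Gz=0$, the decomposition $z=dw+z'$ may be replaced by its image under $1-G$: then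
      -- $d(w-Gw)$ is still a boundary, and $z'-Gz'$ drops one column modulo a boundary.
      have h4 : z = z - cyclicTotalTrace G.entry n z := by rw [hGz, sub_zero]
      rw [h4, map_add, map_sub, add_assoc, ← e']
      simp only [LinearMap.comp_apply] at h3
      rw [h3, e, map_add]
      abel
  obtain ⟨w, z', e, -, h⟩ := key (n + 1)
  have : z' = 0 := funext fun q => h q q.2
  exact ⟨w, by rw [e, this, add_zero]⟩

/-- The inclusion of an algebra as a diagonal entry of `2 × 2` matrices. -/
def cornerInclusion (k : Type v) [CommRing k] (A : Type u) [Ring A] [Algebra k A] (c : Bool) :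
    MatAlgHom k Unit A (Matrix Bool Bool A) where
  entry _ _ := Matrix.singleLinearMap k c c
  entry_mul _ _ x y := by simp

/-- The entries of a `2 × 2` matrix. -/
def matrixEntries (k : Type v) [CommRing k] (A : Type u) [Ring A] [Algebra k A] :
    MatAlgHom k Bool (Matrix Bool Bool A) A where
  entry i j := Matrix.entryLinearMap k A i j
  entry_mul i j X Y := by simp [Matrix.mul_apply]

/-- The familiar identity that the trace of a corner inclusion is the identity: only the constant
cycle at `c` contributes. It holds on chains and for both corners. -/
theorem cyclicTotalTrace_entries_cornerInclusion (c : Bool) (n : ℕ) (z : CyclicTotal k A n) :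
    cyclicTotalTrace (matrixEntries k A).entry n
      (cyclicTotalTrace (cornerInclusion k A c).entry n z) = z := by
  refine funext fun q => ?_
  simp only [cyclicTotalTrace_apply]
  refine (LinearMap.congr_fun (traceMap_comp _ _ _ _ _) _).trans ?_
  refine LinearMap.congr_fun (g := LinearMap.id) ?_ _
  rw [← traceMap_unit_id]
  have h1 (i j : Unit) : (matrixEntries k A).entry c c ∘ₗ (cornerInclusion k A c).entry i j =
      LinearMap.id := by
    ext x
    simp [matrixEntries, cornerInclusion]
  have h2 (i j : Unit × Bool) (hi : i ∉ Set.range fun _ : Unit => ((), c)) :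
      (matrixEntries k A).entry j.2 i.2 ∘ₗ (cornerInclusion k A c).entry j.1 i.1 = 0 := by
    have : c ≠ i.2 := fun h => hi ⟨(), by rw [h]⟩
    ext x
    simp [matrixEntries, cornerInclusion, this]
  exact traceMap_eq_of_injective (fun _ => ((), c)) (fun _ _ _ => rfl) h1 h1 h2 h2 _

/-- The conjugation attached to this decomposition sends $X$ to the matrices $X_{ij}e$, with $e$ the
first diagonal idempotent. It thus factors through the entries of $X$, as the second lemma below
records. -/
theorem sum_single_mul_single :
    ∑ i, (Matrix.single i false 1 : Matrix Bool Bool A) * Matrix.single false i 1 = 1 := by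
  ext i j
  revert i j
  simp [Bool.forall_bool, Matrix.one_apply]

theorem actsTrivially_conj (a b : ι → A) (h : ∑ i, a i * b i = 1) :
    ActsTrivially (conj k a b h) :=
  fun _ z hz => exists_boundary_conj a b h (Bimodule.self k A) z hz

theorem cyclicTotalTrace_cornerInclusion_entries (n : ℕ)
    (z : CyclicTotal k (Matrix Bool Bool A) n) :
    cyclicTotalTrace (conj k _ _ (sum_single_mul_single (A := A))).entry n z =
      cyclicTotalTrace (cornerInclusion k A false).entry n
        (cyclicTotalTrace (matrixEntries k A).entry n z) := by
  refine funext fun q => ?_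
  simp only [cyclicTotalTrace_apply]
  refine Eq.trans ?_ (LinearMap.congr_fun (traceMap_comp _ _ _ _ _) _).symm
  have h1 (i j : Bool) : (cornerInclusion k A false).entry () () ∘ₗ (matrixEntries k A).entry i j =
      (conj k _ _ (sum_single_mul_single (A := A))).entry i j := by
    refine LinearMap.ext fun X => ?_
    ext i' j'
    revert i j i' j'
    simp [Bool.forall_bool, matrixEntries, cornerInclusion, conj_entry_apply, Matrix.mul_apply,
      Matrix.single_apply]
  exact LinearMap.congr_fun (traceMap_eq_of_injective (fun i : Bool => (i, ()))
    (fun _ _ e => by simpa using e) h1 h1 (fun i _ hi => absurd ⟨i.1, rfl⟩ hi)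
    (fun i _ hi => absurd ⟨i.1, rfl⟩ hi) _).symm _

/-- The two diagonal inclusions agree on cyclic homology. -/
theorem exists_cyclicBoundary_cornerInclusion {n : ℕ} {z : CyclicTotal k A n}
    (hz : IsCyclicCycle k z) : ∃ w, cyclicBoundary k (Matrix Bool Bool A) n w =
      cyclicTotalTrace (cornerInclusion k A false).entry n z -
        cyclicTotalTrace (cornerInclusion k A true).entry n z := by
  -- This conjugation factors through the trace of the entries, which returns `z` from either corner
  -- image; hence it kills their difference on chains, as the filtration argument requires.
  refine (actsTrivially_conj _ _ (sum_single_mul_single (A := A))).exists_cyclicBoundary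
    (k := k) ((hz.trace _).sub (hz.trace _)) ?_
  rw [cyclicTotalTrace_cornerInclusion_entries, map_sub,
    cyclicTotalTrace_entries_cornerInclusion, cyclicTotalTrace_entries_cornerInclusion, sub_self,
    map_zero]

theorem cyclicTotalTrace_spread_cornerInclusion_false (a b : ι → A) (h : ∑ i, a i * b i = 1)
    (n : ℕ) (z : CyclicTotal k A n) :
    cyclicTotalTrace (spread k a b h).entry n
      (cyclicTotalTrace (cornerInclusion k A false).entry n z) = z := by
  refine funext fun q => ?_
  simp only [cyclicTotalTrace_apply]
  refine (LinearMap.congr_fun (traceMap_comp _ _ _ _ _) _).trans ?_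
  refine LinearMap.congr_fun (g := LinearMap.id) ?_ _
  rw [← traceMap_unit_id]
  have h1 (i j : Unit) : (spread k a b h).entry none none ∘ₗ (cornerInclusion k A false).entry i j =
      LinearMap.id := by
    ext x
    simp [spread_entry_apply, cornerInclusion, extendByOne]
  have h2 (i j : Unit × Option ι) (hi : i ∉ Set.range fun _ : Unit => ((), none)) :
      (spread k a b h).entry j.2 i.2 ∘ₗ (cornerInclusion k A false).entry j.1 i.1 = 0 := by
    obtain ⟨_, _ | i⟩ := i
    · exact absurd ⟨(), rfl⟩ hi
    · ext x
      simp [spread_entry_apply, cornerInclusion]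
  exact traceMap_eq_of_injective (fun _ => ((), none)) (fun _ _ _ => rfl) h1 h1 h2 h2 _

theorem cyclicTotalTrace_spread_cornerInclusion_true (a b : ι → A) (h : ∑ i, a i * b i = 1)
    (n : ℕ) (z : CyclicTotal k A n) :
    cyclicTotalTrace (spread k a b h).entry n
      (cyclicTotalTrace (cornerInclusion k A true).entry n z) =
        cyclicTotalTrace (conj k a b h).entry n z := by
  refine funext fun q => ?_
  simp only [cyclicTotalTrace_apply]
  refine (LinearMap.congr_fun (traceMap_comp _ _ _ _ _) _).trans (LinearMap.congr_fun ?_ _)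
  have h1 (i j : ι) : (spread k a b h).entry (some i) (some j) ∘ₗ
      (cornerInclusion k A true).entry () () = (conj k a b h).entry i j := by
    ext x
    simp [spread_entry_apply, conj_entry_apply, cornerInclusion, extendByOne]
  have h2 (i j : Unit × Option ι) (hi : i ∉ Set.range fun i : ι => ((), some i)) :
      (spread k a b h).entry j.2 i.2 ∘ₗ (cornerInclusion k A true).entry j.1 i.1 = 0 := by
    obtain ⟨_, _ | i⟩ := i
    · ext x
      simp [spread_entry_apply, cornerInclusion]
    · exact absurd ⟨i, rfl⟩ hi
  exact traceMap_eq_of_injective (fun i => ((), some i)) (fun _ _ e => by simpa using e)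
    h1 h1 h2 h2 _

/-- Conjugations act trivially on cyclic homology. -/
theorem exists_cyclicBoundary_conj (a b : ι → A) (h : ∑ i, a i * b i = 1) {n : ℕ}
    {z : CyclicTotal k A n} (hz : IsCyclicCycle k z) : ∃ w, cyclicBoundary k A n w =
      z - cyclicTotalTrace (conj k a b h).entry n z := by
  obtain ⟨w, hw⟩ := exists_cyclicBoundary_cornerInclusion hz
  refine ⟨cyclicTotalTrace (spread k a b h).entry (n + 1) w, ?_⟩
  refine (LinearMap.congr_fun (cyclicBoundary_comp_cyclicTotalTrace (spread k a b h) n) w).trans ?_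
  rw [LinearMap.comp_apply, hw, map_sub, cyclicTotalTrace_spread_cornerInclusion_false,
    cyclicTotalTrace_spread_cornerInclusion_true]

end CyclicConj

/-! ### Conjugations induce the identity on homology -/

section HomologyConj

variable {k : Type v} [CommRing k] {A B : Type u} [Ring A] [Ring B] [Algebra k A] [Algebra k B]
  {ι κ : Type} [Fintype ι] [Fintype κ]

theorem hochschildComplex_d_apply (M : Bimodule k A A) (n : ℕ) (z : Chains k A M (n + 1)) :
    (hochschildComplex M).d (n + 1) n z = hochschildBoundary k A M n z := by
  simp only [hochschildComplex, ChainComplex.of_d]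
  rfl

theorem cyclicComplex_d_apply (n : ℕ) (z : CyclicTotal k A (n + 1)) :
    (cyclicComplex k A).d (n + 1) n z = cyclicBoundary k A n z := by
  simp only [cyclicComplex, ChainComplex.of_d]
  rfl

theorem homologyMap_hochschildTrace_conj (a b : ι → A) (h : ∑ i, a i * b i = 1)
    (M : Bimodule k A A) (n : ℕ) :
    HomologicalComplex.homologyMap (hochschildTrace (conjHom a b h M)) n = 𝟙 _ := by
  rw [← HomologicalComplex.homologyMap_id]
  refine (homologyMap_eq _ _ n fun z hz => ?_).symm
  have hz' : IsHochschildCycle (M := M) k (show Chains k A M n from z) := by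
    cases n with
    | zero => trivial
    | succ n => exact (hochschildComplex_d_apply M n z).symm.trans (hz n)
  obtain ⟨w, hw⟩ := exists_boundary_conj a b h M _ hz'
  exact ⟨w, (hochschildComplex_d_apply M n w).trans hw⟩

theorem homologyMap_cyclicTrace_conj (a b : ι → A) (h : ∑ i, a i * b i = 1) (n : ℕ) :
    HomologicalComplex.homologyMap (cyclicTrace (conj k a b h)) n = 𝟙 _ := by
  rw [← HomologicalComplex.homologyMap_id]
  refine (homologyMap_eq _ _ n fun z hz => ?_).symm
  have hz' : IsCyclicCycle k (show CyclicTotal k A n from z) := by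
    cases n with
    | zero => trivial
    | succ n => exact (cyclicComplex_d_apply n z).symm.trans (hz n)
  obtain ⟨w, hw⟩ := exists_cyclicBoundary_conj a b h hz'
  exact ⟨w, (cyclicComplex_d_apply n w).trans hw⟩

end HomologyConj

/-! ### Tensor products of bimodules -/

namespace Bimodule

variable {k : Type v} [CommRing k] {A B C : Type u} [Ring A] [Ring B] [Ring C]
  [Algebra k A] [Algebra k B] [Algebra k C] {X : Bimodule k A B} {Y : Bimodule k B C}

/-- The universal balanced bilinear map. -/
def tmulₗ (X : Bimodule k A B) (Y : Bimodule k B C) : X →ₗ[k] Y →ₗ[k] X.tensor Y :=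
  (TensorProduct.mk k X Y).compr₂ (balancing X Y).mkQ

theorem tmulₗ_apply (x : X) (y : Y) : tmulₗ X Y x y = tmul x y := rfl

/-- The linear map on `X ⊗_B Y` given by a balanced bilinear map. -/
def tensorLift {Z : Type*} [AddCommGroup Z] [Module k Z] (β : X →ₗ[k] Y →ₗ[k] Z)
    (hβ : ∀ x (b : B) y, β (op b • x) y = β x (b • y)) : X.tensor Y →ₗ[k] Z :=
  (balancing X Y).liftQ (TensorProduct.lift β) <| by
    rw [balancing, Submodule.span_le]
    rintro _ ⟨x, b, y, rfl⟩
    simp [hβ]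

theorem tensorLift_tmul {Z : Type*} [AddCommGroup Z] [Module k Z] (β : X →ₗ[k] Y →ₗ[k] Z)
    (hβ : ∀ x (b : B) y, β (op b • x) y = β x (b • y)) (x : X) (y : Y) :
    tensorLift β hβ (tmul x y) = β x y :=
  (Submodule.liftQ_apply _ _ _).trans (TensorProduct.lift.tmul _ _)

@[elab_as_elim]
theorem tensor_induction {c : X.tensor Y → Prop} (z : X.tensor Y) (zero : c 0)
    (tmul : ∀ x y, c (tmul x y)) (add : ∀ z w, c z → c w → c (z + w)) : c z := by
  obtain ⟨z, rfl⟩ := Submodule.Quotient.mk_surjective (balancing X Y) z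
  induction z with
  | zero => exact zero
  | tmul x y => exact tmul x y
  | add z w hz hw => exact add _ _ hz hw

theorem exists_eq_sum_tmul (z : X.tensor Y) :
    ∃ (n : ℕ) (x : Fin n → X) (y : Fin n → Y), z = ∑ i, tmul (x i) (y i) := by
  induction z using tensor_induction with
  | zero => exact ⟨0, Fin.elim0, Fin.elim0, by simp⟩
  | tmul x y => exact ⟨1, fun _ => x, fun _ => y, by simp⟩
  | add z w hz hw =>
    obtain ⟨n, x, y, rfl⟩ := hz
    obtain ⟨m, x', y', rfl⟩ := hw
    exact ⟨n + m, Fin.append x x', Fin.append y y', by simp [Fin.sum_univ_add]⟩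

end Bimodule

/-! ### Transfer maps of a Morita context -/

namespace MoritaContext

open Bimodule

variable {k : Type v} [CommRing k] (𝓒 : MoritaContext.{u} k)

/-- The Morita context with the two algebras exchanged. -/
def symm : MoritaContext.{u} k where
  R := 𝓒.S
  S := 𝓒.R
  P := 𝓒.Q
  Q := 𝓒.P
  φ := 𝓒.ψ
  ψ := 𝓒.φ
  φ_smul := 𝓒.ψ_smul
  ψ_smul := 𝓒.φ_smul

/-- The pairing `P × Q → S`. -/
def pairS : 𝓒.P →ₗ[k] 𝓒.Q →ₗ[k] 𝓒.S := (tmulₗ 𝓒.P 𝓒.Q).compr₂ 𝓒.φ.toLinearEquiv.toLinearMap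

/-- The pairing `Q × P → R`. -/
def pairR : 𝓒.Q →ₗ[k] 𝓒.P →ₗ[k] 𝓒.R := 𝓒.symm.pairS

variable {𝓒}

theorem pairS_smul (s : 𝓒.S) (p : 𝓒.P) (q : 𝓒.Q) : 𝓒.pairS (s • p) q = s * 𝓒.pairS p q :=
  𝓒.φ.map_smul s (tmul p q)

theorem pairS_op_smul (s : 𝓒.S) (p : 𝓒.P) (q : 𝓒.Q) :
    𝓒.pairS p (op s • q) = 𝓒.pairS p q * s :=
  𝓒.φ.map_op_smul s (tmul p q)

theorem pairR_smul (r : 𝓒.R) (q : 𝓒.Q) (p : 𝓒.P) : 𝓒.pairR (r • q) p = r * 𝓒.pairR q p :=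
  𝓒.ψ.map_smul r (tmul q p)

theorem pairR_op_smul (r : 𝓒.R) (q : 𝓒.Q) (p : 𝓒.P) :
    𝓒.pairR q (op r • p) = 𝓒.pairR q p * r :=
  𝓒.ψ.map_op_smul r (tmul q p)

theorem pairR_balanced (s : 𝓒.S) (q : 𝓒.Q) (p : 𝓒.P) :
    𝓒.pairR (op s • q) p = 𝓒.pairR q (s • p) :=
  congrArg 𝓒.ψ.toLinearEquiv (tmul_balanced q s p)

theorem pairS_smul_eq (p : 𝓒.P) (q : 𝓒.Q) (p' : 𝓒.P) :
    𝓒.pairS p q • p' = op (𝓒.pairR q p') • p := 𝓒.φ_smul p q p'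

theorem pairR_smul_eq (q : 𝓒.Q) (p : 𝓒.P) (q' : 𝓒.Q) :
    𝓒.pairR q p • q' = op (𝓒.pairS p q') • q := 𝓒.ψ_smul q p q'

variable (𝓒) in
-- Expand $\varphi^{-1}(1)$ in pure tensors. All transfer maps are built from such decompositions of
-- the two units.
theorem exists_sum_pairS :
    ∃ (n : ℕ) (p : Fin n → 𝓒.P) (q : Fin n → 𝓒.Q), ∑ i, 𝓒.pairS (p i) (q i) = 1 := by
  obtain ⟨n, p, q, h⟩ := exists_eq_sum_tmul (𝓒.φ.toLinearEquiv.symm (1 : 𝓒.S))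
  refine ⟨n, p, q, ?_⟩
  have := congrArg 𝓒.φ.toLinearEquiv h
  rw [LinearEquiv.apply_symm_apply, map_sum] at this
  exact this.symm

variable (𝓒) in
theorem exists_sum_pairR :
    ∃ (n : ℕ) (p : Fin n → 𝓒.P) (q : Fin n → 𝓒.Q), ∑ i, 𝓒.pairR (q i) (p i) = 1 := by
  obtain ⟨n, q, p, h⟩ := 𝓒.symm.exists_sum_pairS
  exact ⟨n, p, q, h⟩

variable {ι κ : Type} [Fintype ι] [Fintype κ]

/-- The map `r ↦ (pᵢ r ⊗ qⱼ)` from `R` to matrices over `S`. -/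
def transfer (p : ι → 𝓒.P) (q : ι → 𝓒.Q) (h : ∑ i, 𝓒.pairR (q i) (p i) = 1) :
    MatAlgHom k ι 𝓒.R 𝓒.S where
  entry i j := 𝓒.pairS (p i) ∘ₗ (LinearMap.toSpanSingleton 𝓒.R 𝓒.Q (q j)).restrictScalars k
  entry_mul i j x y := by
    change 𝓒.pairS (p i) ((x * y) • q j) =
      ∑ l, 𝓒.pairS (p i) (x • q l) * 𝓒.pairS (p l) (y • q j)
    -- Insert $1=\sum_l\psi(q_l\otimes p_l)$ between $x$ and $y$; then $\psi(q_l\otimes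
    -- p_l)yq_j=q_l\varphi(p_l\otimes yq_j)$ splits the pairing into a product in $S$.
    have : (x * y) • q j = x • (∑ l, 𝓒.pairR (q l) (p l)) • y • q j := by
      rw [h, one_smul, mul_smul]
    rw [this, Finset.sum_smul, Finset.smul_sum, map_sum]
    refine Finset.sum_congr rfl fun l _ => ?_
    rw [pairR_smul_eq, smul_comm, pairS_op_smul]

theorem transfer_entry_apply (p : ι → 𝓒.P) (q : ι → 𝓒.Q) (h : ∑ i, 𝓒.pairR (q i) (p i) = 1)
    (i j : ι) (r : 𝓒.R) : (transfer p q h).entry i j r = 𝓒.pairS (p i) (r • q j) := rfl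

/-- The map `m ↦ (pᵢ ⊗ m ⊗ qⱼ)` from `M` to matrices over `P ⊗_R M ⊗_R Q`. -/
def transferHom (p : ι → 𝓒.P) (q : ι → 𝓒.Q) (h : ∑ i, 𝓒.pairR (q i) (p i) = 1)
    (M : Bimodule k 𝓒.R 𝓒.R) : MatHom (transfer p q h) M (𝓒.baseChange M) where
  entry i j := (tmulₗ (𝓒.P.tensor M) 𝓒.Q).flip (q j) ∘ₗ tmulₗ 𝓒.P M (p i)
  entry_smul i j x m := by
    change tmul (tmul (p i) (x • m)) (q j) =
      ∑ l, 𝓒.pairS (p i) (x • q l) • tmul (tmul (p l) m) (q j)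
    -- Here $\varphi(p_i\otimes xq_l)p_l=p_ix\psi(q_l\otimes p_l)$, and the sum over $l$ is $p_ix$,
    -- which is moved across the tensor sign.
    have (l : ι) : 𝓒.pairS (p i) (x • q l) • tmul (tmul (p l) m) (q j) =
        (tmulₗ (𝓒.P.tensor M) 𝓒.Q).flip (q j) ((tmulₗ 𝓒.P M).flip m
          (op (x * 𝓒.pairR (q l) (p l)) • p i)) := by
      rw [← pairR_smul, ← pairS_smul_eq]
      rfl
    simp only [this, ← map_sum, ← Finset.sum_smul, ← Finset.op_sum, ← Finset.mul_sum, h, mul_one]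
    exact congrArg (fun t => tmul t (q j)) (tmul_balanced (p i) x m).symm
  entry_op_smul i j x m := by
    change tmul (tmul (p i) (op x • m)) (q j) =
      ∑ l, op (𝓒.pairS (p l) (x • q j)) • tmul (tmul (p i) m) (q l)
    have (l : ι) : op (𝓒.pairS (p l) (x • q j)) • tmul (tmul (p i) m) (q l) =
        tmulₗ (𝓒.P.tensor M) 𝓒.Q (tmul (p i) m) (𝓒.pairR (q l) (p l) • x • q j) := by
      rw [pairR_smul_eq]
      rfl
    simp only [this, ← map_sum, ← Finset.sum_smul, h, one_smul]
    exact tmul_balanced (tmul (p i) m) x (q j)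

theorem transferHom_entry_apply (p : ι → 𝓒.P) (q : ι → 𝓒.Q) (h : ∑ i, 𝓒.pairR (q i) (p i) = 1)
    (M : Bimodule k 𝓒.R 𝓒.R) (i j : ι) (m : M) :
    (transferHom p q h M).entry i j m = tmul (tmul (p i) m) (q j) := rfl

/-- The map `p ⊗ m ↦ (q ⊗ p) m`. -/
def contractLeft (q : 𝓒.Q) (M : Bimodule k 𝓒.R 𝓒.R) : 𝓒.P.tensor M →ₗ[k] M :=
  tensorLift ((Algebra.lsmul k k M).toLinearMap ∘ₗ 𝓒.pairR q) fun p r m => by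
    simp [pairR_op_smul]

theorem contractLeft_tmul (q : 𝓒.Q) (M : Bimodule k 𝓒.R 𝓒.R) (p : 𝓒.P) (m : M) :
    contractLeft q M (tmul p m) = 𝓒.pairR q p • m := tensorLift_tmul _ _ _ _

/-- Right linearity over $R$ is needed for `contract` to be balanced over the second tensor sign. -/
theorem contractLeft_op_smul (q : 𝓒.Q) (M : Bimodule k 𝓒.R 𝓒.R) (r : 𝓒.R) (t : 𝓒.P.tensor M) :
    contractLeft q M (op r • t) = op r • contractLeft q M t := by
  induction t using tensor_induction with
  | zero => rw [smul_zero, map_zero, smul_zero]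
  | tmul p m => rw [op_smul_tmul, contractLeft_tmul, contractLeft_tmul, smul_comm]
  | add z w hz hw => rw [smul_add, map_add, hz, hw, map_add, smul_add]

/-- The map `p ⊗ m ⊗ q' ↦ (q ⊗ p) m (q' ⊗ p')`. -/
def contract (q : 𝓒.Q) (p' : 𝓒.P) (M : Bimodule k 𝓒.R 𝓒.R) : 𝓒.baseChange M →ₗ[k] M :=
  tensorLift (X := 𝓒.P.tensor M) (Y := 𝓒.Q)
    (((Algebra.lsmul k k M).toLinearMap ∘ₗ (opLinearEquiv k).toLinearMap ∘ₗ
      𝓒.pairR.flip p').flip ∘ₗ contractLeft q M) fun t r q' => by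
    simp [contractLeft_op_smul, pairR_smul]

theorem contract_tmul (q : 𝓒.Q) (p' : 𝓒.P) (M : Bimodule k 𝓒.R 𝓒.R) (p : 𝓒.P) (m : M) (q' : 𝓒.Q) :
    contract q p' M (tmul (tmul p m) q') = op (𝓒.pairR q' p') • 𝓒.pairR q p • m :=
  (tensorLift_tmul _ _ _ _).trans (by simp [contractLeft_tmul])

@[elab_as_elim]
theorem baseChange_induction {M : Bimodule k 𝓒.R 𝓒.R} {c : 𝓒.baseChange M → Prop}
    (z : 𝓒.baseChange M) (zero : c 0) (tmul : ∀ p m q, c (tmul (tmul p m) q))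
    (add : ∀ z w, c z → c w → c (z + w)) : c z := by
  refine tensor_induction (c := c) z zero (fun t q => ?_) add
  induction t using tensor_induction with
  | zero =>
    have := (tmulₗ (𝓒.P.tensor M) 𝓒.Q).map_zero₂ q
    rw [tmulₗ_apply] at this
    rwa [this]
  | tmul p m => exact tmul p m q
  | add t t' hc hc' =>
    have := (tmulₗ (𝓒.P.tensor M) 𝓒.Q).map_add₂ t t' q
    simp only [tmulₗ_apply] at this
    rw [this]
    exact add _ _ hc hc'

/-- The map `s ↦ (qᵢ s ⊗ pⱼ)` from `S` to matrices over `R`. -/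
def transferBack (p' : κ → 𝓒.P) (q' : κ → 𝓒.Q) (h : ∑ i, 𝓒.pairS (p' i) (q' i) = 1) :
    MatAlgHom k κ 𝓒.S 𝓒.R :=
  transfer (𝓒 := 𝓒.symm) q' p' h

/-- The map `p ⊗ m ⊗ q ↦ ((qᵢ ⊗ p) m (q ⊗ pⱼ))` from `P ⊗_R M ⊗_R Q` to matrices over `M`. -/
def transferBackHom (p' : κ → 𝓒.P) (q' : κ → 𝓒.Q) (h : ∑ i, 𝓒.pairS (p' i) (q' i) = 1)
    (M : Bimodule k 𝓒.R 𝓒.R) :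
    MatHom (transferBack p' q' h) (𝓒.baseChange M) M where
  -- Applying `transferHom` to the exchanged context would land in
  -- $Q\otimes_S(P\otimes_RM\otimes_RQ)\otimes_SP$. The contraction evaluates both pairings and
  -- lands in $M$ directly.
  entry i j := contract (q' i) (p' j) M
  entry_smul i j s z := by
    change contract (q' i) (p' j) M (s • z) =
      ∑ l, 𝓒.pairR (q' i) (s • p' l) • contract (q' l) (p' j) M z
    induction z using baseChange_induction with
    | zero => simp
    | add z w hz hw => simp only [smul_add, map_add, hz, hw, Finset.sum_add_distrib]
    | tmul p m q =>
      have e : 𝓒.pairR (q' i) (s • p) = ∑ l, 𝓒.pairR (q' i) (s • p' l) * 𝓒.pairR (q' l) p := by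
        have : s • p = s • (∑ l, 𝓒.pairS (p' l) (q' l)) • p := by rw [h, one_smul]
        rw [this, Finset.sum_smul, Finset.smul_sum, map_sum]
        refine Finset.sum_congr rfl fun l _ => ?_
        rw [pairS_smul_eq, smul_comm, pairR_op_smul]
      change contract (q' i) (p' j) M (tmul (tmul (s • p) m) q) = _
      simp only [contract_tmul, e, Finset.sum_smul, Finset.smul_sum, mul_smul]
      refine Finset.sum_congr rfl fun l _ => ?_
      exact (smul_comm _ _ _).symm
  entry_op_smul i j s z := by
    change contract (q' i) (p' j) M (op s • z) =
      ∑ l, op (𝓒.pairR (q' l) (s • p' j)) • contract (q' i) (p' l) M z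
    induction z using baseChange_induction with
    | zero => simp
    | add z w hz hw => simp only [smul_add, map_add, hz, hw, Finset.sum_add_distrib]
    | tmul p m q =>
      have key (p₀ : 𝓒.P) : 𝓒.pairR q p₀ = ∑ l, 𝓒.pairR q (p' l) * 𝓒.pairR (q' l) p₀ := by
        have : p₀ = (∑ l, 𝓒.pairS (p' l) (q' l)) • p₀ := by rw [h, one_smul]
        conv_lhs => rw [this, Finset.sum_smul, map_sum]
        simp only [pairS_smul_eq, pairR_op_smul]
      have e := (pairR_balanced s q (p' j)).trans (key (s • p' j))
      change contract (q' i) (p' j) M (tmul (tmul p m) (op s • q)) = _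
      simp only [contract_tmul, e, Finset.op_sum, Finset.sum_smul, op_mul, mul_smul]

theorem transferBackHom_entry_apply (p' : κ → 𝓒.P) (q' : κ → 𝓒.Q)
    (h : ∑ i, 𝓒.pairS (p' i) (q' i) = 1) (M : Bimodule k 𝓒.R 𝓒.R) (i j : κ) (p : 𝓒.P) (m : M)
    (q : 𝓒.Q) : (transferBackHom p' q' h M).entry i j (tmul (tmul p m) q) =
      op (𝓒.pairR q (p' j)) • 𝓒.pairR (q' i) p • m := contract_tmul _ _ _ _ _ _

/-- Since $p'_l\psi(q'_l\otimes p_i)=\varphi(p'_l\otimes q'_l)p_i$, the sum over $l$ collapses to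
$\psi(q_i\otimes p_i)$. The two factors are the coefficients $a$ and $b$ of the conjugation that the
composite on $R$ turns out to be. -/
theorem sum_pairR_mul_pairR {p : ι → 𝓒.P} {q : ι → 𝓒.Q} (h : ∑ i, 𝓒.pairR (q i) (p i) = 1)
    {p' : κ → 𝓒.P} {q' : κ → 𝓒.Q} (h' : ∑ i, 𝓒.pairS (p' i) (q' i) = 1) :
    ∑ i : ι × κ, 𝓒.pairR (q i.1) (p' i.2) * 𝓒.pairR (q' i.2) (p i.1) = 1 := by
  rw [Fintype.sum_prod_type, ← h]
  refine Finset.sum_congr rfl fun i _ => ?_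
  have : p i = (∑ l, 𝓒.pairS (p' l) (q' l)) • p i := by rw [h', one_smul]
  conv_rhs => rw [this, Finset.sum_smul, map_sum]
  simp only [pairS_smul_eq, pairR_op_smul]

theorem sum_pairS_mul_pairS {p : ι → 𝓒.P} {q : ι → 𝓒.Q} (h : ∑ i, 𝓒.pairR (q i) (p i) = 1)
    {p' : κ → 𝓒.P} {q' : κ → 𝓒.Q} (h' : ∑ i, 𝓒.pairS (p' i) (q' i) = 1) :
    ∑ i : κ × ι, 𝓒.pairS (p' i.1) (q i.2) * 𝓒.pairS (p i.2) (q' i.1) = 1 :=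
  sum_pairR_mul_pairR (𝓒 := 𝓒.symm) (p := q') (q := p') (p' := q) (q' := p) h' h

/-- The Morita identities factor the iterated pairing: $\psi(q'\otimes\varphi(p\otimes
xq)p')=\psi(q'\otimes p)\,x\,\psi(q\otimes p')$. -/
theorem transfer_comp_entry {p : ι → 𝓒.P} {q : ι → 𝓒.Q} (h : ∑ i, 𝓒.pairR (q i) (p i) = 1)
    {p' : κ → 𝓒.P} {q' : κ → 𝓒.Q} (h' : ∑ i, 𝓒.pairS (p' i) (q' i) = 1) :
    (fun i j : ι × κ => (transferBack p' q' h').entry i.2 j.2 ∘ₗ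
      (transfer p q h).entry i.1 j.1) = (conj k _ _ (sum_pairR_mul_pairR h h')).entry := by
  refine funext fun i => funext fun j => LinearMap.ext fun x => ?_
  change 𝓒.pairR (q' i.2) (𝓒.pairS (p i.1) (x • q j.1) • p' j.2) =
    𝓒.pairR (q' i.2) (p i.1) * (x * 𝓒.pairR (q j.1) (p' j.2))
  rw [pairS_smul_eq, pairR_op_smul, pairR_smul]

theorem transferBack_comp_entry {p : ι → 𝓒.P} {q : ι → 𝓒.Q} (h : ∑ i, 𝓒.pairR (q i) (p i) = 1)
    {p' : κ → 𝓒.P} {q' : κ → 𝓒.Q} (h' : ∑ i, 𝓒.pairS (p' i) (q' i) = 1) :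
    (fun i j : κ × ι => (transfer p q h).entry i.2 j.2 ∘ₗ (transferBack p' q' h').entry i.1 j.1) =
      (conj k _ _ (sum_pairS_mul_pairS h h')).entry := by
  refine funext fun i => funext fun j => LinearMap.ext fun x => ?_
  change 𝓒.pairS (p i.2) (𝓒.pairR (q' i.1) (x • p' j.1) • q j.2) =
    𝓒.pairS (p i.2) (q' i.1) * (x * 𝓒.pairS (p' j.1) (q j.2))
  rw [pairR_smul_eq, pairS_op_smul, pairS_smul]

theorem hochschildTrace_transfer_comp_back {p : ι → 𝓒.P} {q : ι → 𝓒.Q}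
    (h : ∑ i, 𝓒.pairR (q i) (p i) = 1) {p' : κ → 𝓒.P} {q' : κ → 𝓒.Q}
    (h' : ∑ i, 𝓒.pairS (p' i) (q' i) = 1) (M : Bimodule k 𝓒.R 𝓒.R) :
    hochschildTrace (transferHom p q h M) ≫ hochschildTrace (transferBackHom p' q' h' M) =
      hochschildTrace (conjHom _ _ (sum_pairR_mul_pairR h h') M) := by
  refine hochschildComplex_hom_ext fun n z => (LinearMap.congr_fun (traceMap_comp
    (transfer p q h).entry (transferHom p q h M).entry (transferBack p' q' h').entry
    (transferBackHom p' q' h' M).entry n) z).trans ?_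
  have e : (fun i j : ι × κ => (transferBackHom p' q' h' M).entry i.2 j.2 ∘ₗ
      (transferHom p q h M).entry i.1 j.1) = (conjHom _ _ (sum_pairR_mul_pairR h h') M).entry := by
    refine funext fun i => funext fun j => LinearMap.ext fun x => ?_
    rw [LinearMap.comp_apply, transferHom_entry_apply, transferBackHom_entry_apply,
      conjHom_entry_apply]
    exact (smul_comm _ _ _).symm
  rw [e]
  rw [transfer_comp_entry h h']
  rfl

theorem hochschildTrace_back_comp_transfer {p : ι → 𝓒.P} {q : ι → 𝓒.Q}
    (h : ∑ i, 𝓒.pairR (q i) (p i) = 1) {p' : κ → 𝓒.P} {q' : κ → 𝓒.Q}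
    (h' : ∑ i, 𝓒.pairS (p' i) (q' i) = 1) (M : Bimodule k 𝓒.R 𝓒.R) :
    hochschildTrace (transferBackHom p' q' h' M) ≫ hochschildTrace (transferHom p q h M) =
      hochschildTrace (conjHom _ _ (sum_pairS_mul_pairS h h') (𝓒.baseChange M)) := by
  refine hochschildComplex_hom_ext fun n z => (LinearMap.congr_fun (traceMap_comp
    (transferBack p' q' h').entry (transferBackHom p' q' h' M).entry
    (transfer p q h).entry (transferHom p q h M).entry n) z).trans ?_
  have e : (fun i j : κ × ι => (transferHom p q h M).entry i.2 j.2 ∘ₗ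
      (transferBackHom p' q' h' M).entry i.1 j.1) =
        (conjHom _ _ (sum_pairS_mul_pairS h h') (𝓒.baseChange M)).entry := by
    refine funext fun i => funext fun j => LinearMap.ext fun x => ?_
    rw [LinearMap.comp_apply, conjHom_entry_apply]
    induction x using baseChange_induction with
    | zero => simp
    | add z w hz hw => simp only [map_add, smul_add, hz, hw]
    | tmul p₀ m q₀ =>
      rw [transferBackHom_entry_apply, transferHom_entry_apply]
      -- Both outer factors are rewritten by the Morita identities, $\varphi(p_i\otimes
      -- q'_i)p_0=p_i\psi(q'_i\otimes p_0)$ and $q_0\varphi(p'_j\otimes q_j)=\psi(q_0\otimes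
      -- p'_j)q_j$; balancing then moves the scalars from $R$ onto $m$.
      change _ = tmul (tmul (𝓒.pairS (p i.2) (q' i.1) • p₀) m) (op (𝓒.pairS (p' j.1) (q j.2)) • q₀)
      rw [pairS_smul_eq, ← pairR_smul_eq, ← tmul_balanced, op_smul_tmul, tmul_balanced (p i.2),
        smul_comm (𝓒.pairR (q' i.1) p₀)]
  rw [e, transferBack_comp_entry h h']
  rfl

theorem cyclicTrace_transfer_comp_back {p : ι → 𝓒.P} {q : ι → 𝓒.Q}
    (h : ∑ i, 𝓒.pairR (q i) (p i) = 1) {p' : κ → 𝓒.P} {q' : κ → 𝓒.Q}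
    (h' : ∑ i, 𝓒.pairS (p' i) (q' i) = 1) :
    cyclicTrace (transfer p q h) ≫ cyclicTrace (transferBack p' q' h') =
      cyclicTrace (conj k _ _ (sum_pairR_mul_pairR h h')) := by
  refine cyclicComplex_hom_ext fun n z => funext fun i => (LinearMap.congr_fun (traceMap_comp
    (transfer p q h).entry (transfer p q h).entry (transferBack p' q' h').entry
    (transferBack p' q' h').entry i) (z i)).trans ?_
  rw [transfer_comp_entry h h']
  rfl

theorem cyclicTrace_back_comp_transfer {p : ι → 𝓒.P} {q : ι → 𝓒.Q}
    (h : ∑ i, 𝓒.pairR (q i) (p i) = 1) {p' : κ → 𝓒.P} {q' : κ → 𝓒.Q}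
    (h' : ∑ i, 𝓒.pairS (p' i) (q' i) = 1) :
    cyclicTrace (transferBack p' q' h') ≫ cyclicTrace (transfer p q h) =
      cyclicTrace (conj k _ _ (sum_pairS_mul_pairS h h')) := by
  refine cyclicComplex_hom_ext fun n z => funext fun i => (LinearMap.congr_fun (traceMap_comp
    (transferBack p' q' h').entry (transferBack p' q' h').entry (transfer p q h).entry
    (transfer p q h).entry i) (z i)).trans ?_
  rw [transferBack_comp_entry h h']
  rfl

/-- The isomorphism `H_n(R, M) ≅ H_n(S, P ⊗_R M ⊗_R Q)` given by decompositions of the units. -/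
def hochschildIso {p : ι → 𝓒.P} {q : ι → 𝓒.Q} (h : ∑ i, 𝓒.pairR (q i) (p i) = 1)
    {p' : κ → 𝓒.P} {q' : κ → 𝓒.Q} (h' : ∑ i, 𝓒.pairS (p' i) (q' i) = 1) (n : ℕ)
    (M : Bimodule k 𝓒.R 𝓒.R) : hochschildHomology n M ≅ hochschildHomology n (𝓒.baseChange M) where
  hom := HomologicalComplex.homologyMap (hochschildTrace (transferHom p q h M)) n
  inv := HomologicalComplex.homologyMap (hochschildTrace (transferBackHom p' q' h' M)) n
  hom_inv_id := (HomologicalComplex.homologyMap_comp _ _ n).symm.trans <| by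
    rw [hochschildTrace_transfer_comp_back, homologyMap_hochschildTrace_conj]
    rfl
  inv_hom_id := (HomologicalComplex.homologyMap_comp _ _ n).symm.trans <| by
    rw [hochschildTrace_back_comp_transfer, homologyMap_hochschildTrace_conj]
    rfl

/-- The isomorphism `HC_n(R) ≅ HC_n(S)` given by decompositions of the units. -/
def cyclicIso {p : ι → 𝓒.P} {q : ι → 𝓒.Q} (h : ∑ i, 𝓒.pairR (q i) (p i) = 1)
    {p' : κ → 𝓒.P} {q' : κ → 𝓒.Q} (h' : ∑ i, 𝓒.pairS (p' i) (q' i) = 1) (n : ℕ) :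
    cyclicHomology k 𝓒.R n ≅ cyclicHomology k 𝓒.S n where
  hom := HomologicalComplex.homologyMap (cyclicTrace (transfer p q h)) n
  inv := HomologicalComplex.homologyMap (cyclicTrace (transferBack p' q' h')) n
  hom_inv_id := (HomologicalComplex.homologyMap_comp _ _ n).symm.trans <| by
    rw [cyclicTrace_transfer_comp_back, homologyMap_cyclicTrace_conj]
    rfl
  inv_hom_id := (HomologicalComplex.homologyMap_comp _ _ n).symm.trans <| by
    rw [cyclicTrace_back_comp_transfer, homologyMap_cyclicTrace_conj]
    rfl

/-- Fix a decomposition of $1_S$. The inverse isomorphism depends on it alone, so isomorphisms from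
different decompositions of $1_R$ have the same inverse and coincide. -/
theorem homologyMap_hochschildTrace_transfer_eq {ι' : Type} [Fintype ι'] {p : ι → 𝓒.P}
    {q : ι → 𝓒.Q} (h : ∑ i, 𝓒.pairR (q i) (p i) = 1) {p₁ : ι' → 𝓒.P} {q₁ : ι' → 𝓒.Q}
    (h₁ : ∑ i, 𝓒.pairR (q₁ i) (p₁ i) = 1) (n : ℕ) (M : Bimodule k 𝓒.R 𝓒.R) :
    HomologicalComplex.homologyMap (hochschildTrace (transferHom p q h M)) n =
      HomologicalComplex.homologyMap (hochschildTrace (transferHom p₁ q₁ h₁ M)) n := by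
  obtain ⟨m, p', q', h'⟩ := 𝓒.exists_sum_pairS
  have : hochschildIso h h' n M = hochschildIso h₁ h' n M := Iso.ext_inv rfl
  exact congrArg Iso.hom this

theorem homologyMap_cyclicTrace_transfer_eq {ι' : Type} [Fintype ι'] {p : ι → 𝓒.P}
    {q : ι → 𝓒.Q} (h : ∑ i, 𝓒.pairR (q i) (p i) = 1) {p₁ : ι' → 𝓒.P} {q₁ : ι' → 𝓒.Q}
    (h₁ : ∑ i, 𝓒.pairR (q₁ i) (p₁ i) = 1) (n : ℕ) :
    HomologicalComplex.homologyMap (cyclicTrace (transfer p q h)) n =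
      HomologicalComplex.homologyMap (cyclicTrace (transfer p₁ q₁ h₁)) n := by
  obtain ⟨m, p', q', h'⟩ := 𝓒.exists_sum_pairS
  have : cyclicIso h h' n = cyclicIso h₁ h' n := Iso.ext_inv rfl
  exact congrArg Iso.hom this

/-! ### Naturality -/

variable {𝓓 : MoritaContext.{u} k} (F : Hom 𝓒 𝓓)

theorem Hom.map_pairS (p : 𝓒.P) (q : 𝓒.Q) :
    𝓓.pairS (F.onP.toLinearMap p) (F.onQ.toLinearMap q) = F.onS (𝓒.pairS p q) :=
  F.map_φ (tmul p q)

theorem Hom.map_pairR (q : 𝓒.Q) (p : 𝓒.P) :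
    𝓓.pairR (F.onQ.toLinearMap q) (F.onP.toLinearMap p) = F.onR (𝓒.pairR q p) :=
  F.map_ψ (tmul q p)

theorem Hom.sum_map_pairR {p : ι → 𝓒.P} {q : ι → 𝓒.Q} (h : ∑ i, 𝓒.pairR (q i) (p i) = 1) :
    ∑ i, 𝓓.pairR (F.onQ.toLinearMap (q i)) (F.onP.toLinearMap (p i)) = 1 := by
  simp only [F.map_pairR, ← map_sum, h, map_one]

theorem Hom.map_transfer_entry {p : ι → 𝓒.P} {q : ι → 𝓒.Q} (h : ∑ i, 𝓒.pairR (q i) (p i) = 1)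
    (i j : ι) (r : 𝓒.R) : F.onS ((transfer p q h).entry i j r) =
      (transfer _ _ (F.sum_map_pairR h)).entry i j (F.onR r) := by
  rw [transfer_entry_apply, transfer_entry_apply, ← F.map_pairS, F.onQ.map_smul]

/-- The square commutes on chains provided the target uses the transported decomposition; passing to
another one is possible only on homology. -/
theorem Hom.hochschildTrace_comp {p : ι → 𝓒.P} {q : ι → 𝓒.Q}
    (h : ∑ i, 𝓒.pairR (q i) (p i) = 1) {M : Bimodule k 𝓒.R 𝓒.R} {M' : Bimodule k 𝓓.R 𝓓.R}
    (μ : HomOver F.onR F.onR M M') :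
    hochschildTrace (transferHom p q h M) ≫ hochschildComplexMap (F.baseChange μ) =
      hochschildComplexMap μ ≫ hochschildTrace (transferHom _ _ (F.sum_map_pairR h) M') :=
  hochschildComplex_hom_ext fun n z => LinearMap.congr_fun (chainsMap_comp_traceMap F.onR F.onS
    μ.toLinearMap (F.baseChange μ).toLinearMap (F.map_transfer_entry h) (fun _ _ _ => rfl) n) z

theorem Hom.cyclicTrace_comp {p : ι → 𝓒.P} {q : ι → 𝓒.Q} (h : ∑ i, 𝓒.pairR (q i) (p i) = 1) :
    cyclicTrace (transfer p q h) ≫ cyclicComplexMap F.onS =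
      cyclicComplexMap F.onR ≫ cyclicTrace (transfer _ _ (F.sum_map_pairR h)) :=
  cyclicComplex_hom_ext fun _ z => funext fun i => LinearMap.congr_fun
    (chainsMap_comp_traceMap F.onR F.onS F.onR.toLinearMap F.onS.toLinearMap
      (F.map_transfer_entry h) (F.map_transfer_entry h) i) (z i)

end MoritaContext

end

end MoritaInvariance

theorem corollary5p1 (k : Type v) [CommRing k] :
    (∃ e : ∀ (n : ℕ) (𝓒 : MoritaContext.{u} k) (M : Bimodule k 𝓒.R 𝓒.R),
        hochschildHomology n M ≅ hochschildHomology n (𝓒.baseChange M),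
      ∀ (n : ℕ) (𝓒 𝓓 : MoritaContext.{u} k) (F : 𝓒.Hom 𝓓) (M : Bimodule k 𝓒.R 𝓒.R)
        (M' : Bimodule k 𝓓.R 𝓓.R) (μ : Bimodule.HomOver F.onR F.onR M M'),
        (e n 𝓒 M).hom ≫ hochschildHomologyMap n (F.baseChange μ) =
          hochschildHomologyMap n μ ≫ (e n 𝓓 M').hom) ∧
    (∃ e : ∀ (n : ℕ) (𝓒 : MoritaContext.{u} k), cyclicHomology k 𝓒.R n ≅ cyclicHomology k 𝓒.S n,
      ∀ (n : ℕ) (𝓒 𝓓 : MoritaContext.{u} k) (F : 𝓒.Hom 𝓓),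
        (e n 𝓒).hom ≫ cyclicHomologyMap F.onS n = cyclicHomologyMap F.onR n ≫ (e n 𝓓).hom) := by
  -- Decompositions are chosen for each context separately, with no compatibility along morphisms;
  -- independence of the choice on homology repairs this in both naturality squares.
  choose a p q h using fun 𝓒 : MoritaContext.{u} k => 𝓒.exists_sum_pairR
  choose b p' q' h' using fun 𝓒 : MoritaContext.{u} k => 𝓒.exists_sum_pairS
  refine ⟨⟨fun n 𝓒 M => MoritaContext.hochschildIso (h 𝓒) (h' 𝓒) n M, ?_⟩,
    ⟨fun n 𝓒 => MoritaContext.cyclicIso (h 𝓒) (h' 𝓒) n, ?_⟩⟩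
  · intro n 𝓒 𝓓 F M M' μ
    change HomologicalComplex.homologyMap _ n ≫ HomologicalComplex.homologyMap _ n =
      HomologicalComplex.homologyMap _ n ≫ HomologicalComplex.homologyMap _ n
    rw [← HomologicalComplex.homologyMap_comp, F.hochschildTrace_comp,
      HomologicalComplex.homologyMap_comp,
      MoritaContext.homologyMap_hochschildTrace_transfer_eq (F.sum_map_pairR (h 𝓒)) (h 𝓓)]
  · intro n 𝓒 𝓓 F
    change HomologicalComplex.homologyMap _ n ≫ HomologicalComplex.homologyMap _ n =
      HomologicalComplex.homologyMap _ n ≫ HomologicalComplex.homologyMap _ n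
    rw [← HomologicalComplex.homologyMap_comp, F.cyclicTrace_comp,
      HomologicalComplex.homologyMap_comp,
      MoritaContext.homologyMap_cyclicTrace_transfer_eq (F.sum_map_pairR (h 𝓒)) (h 𝓓)]
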